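/- Let $\mathcal X$ be a measurable space, $\mathcal X^\dagger$ a real Hilbert space, $R\ge 0$, and let $\Phi$ be a space of feature maps $\phi:\mathcal X\to\mathcal X^\dagger$ with $\|\phi(x)\|\le R$ for all $\phi\in\Phi$, $x\in\mathcal X$ (in particular $R=1$ when $\|\phi\|\le 1$ everywhere). $\Phi$ carries a $\sigma$-algebra for which $(\phi,x)\mapsto\phi(x)$ is jointly strongly measurable. Let $\mathcal D$ be a probability distribution on $\mathcal X\times\{+1,-1\}$. For $f:\mathcal X\to\mathbb R$ and a sample $S=((x_1,y_1),\dots,(x_m,y_m))$ put $$L(f)=\Pr_{(x,y)\sim\mathcal D}\{y f(x)\le 0\},\qquad \hat L_\gamma(f)=\frac1m\bigl|\{i: y_i f(x_i)<\gamma\}\bigr| .$$ For $w\in\mathcal X^\dagger$ and a probability measure $Q^\Phi$ on $\Phi$ let $Q$ be the distribution of the random predictor $f_\phi(x)=\langle w,\phi(x)\rangle$, $\phi\sim Q^\Phi$, and write $L(Q)=\mathbb E_{\phi\sim Q^\Phi}L(f_\phi)$ and $\hat L_\gamma(Q)=\mathbb E_{\phi\sim Q^\Phi}\hat L_\gamma(f_\phi)$.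 Then for every prior probability measure $P_0^\Phi$ on $\Phi$, every $m\ge 1$ and every $\delta\in(0,1)$, with probability at least $1-\delta$ over an i.i.d. sample $S\sim\mathcal D^m$, the following holds simultaneously for all $\gamma>0$, all $w$ with $\|w\|\le 1$ and all probability measures $Q^\Phi$ on $\Phi$ (which may depend on $S$): $$L(Q)\le \hat L_\gamma(Q)+\sqrt{\frac{\hat L_\gamma(Q)\,\Delta}{m}}+\frac{\Delta+\sqrt{\Delta}+2}{m},$$ where $$\Delta=2\log(2/\delta)+9(R/\gamma)^2\log m+2\,\mathrm{KL}(Q^\Phi,P_0^\Phi);$$ when $\mathrm{KL}(Q^\Phi,P_0^\Phi)=\infty$ the right-hand side is read as $+\infty$ and nothing is claimed. -/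

import Mathlib

open MeasureTheory

noncomputable section

/-- The labels `+1` and `-1` of binary classification, as real numbers. -/
abbrev BinaryLabel : Type := ({1, -1} : Set ℝ)

/-- The binary margin `M(f, (x, y)) = y f(x)`. -/
def binaryMargin {X : Type*} (f : X → ℝ) (z : X × BinaryLabel) : ℝ :=
  (z.2 : ℝ) * f z.1

/-- The margin error `L_γ(f)`, the probability under `D` that `M(f, z) ≤ γ`. -/
def marginError {X : Type*} [MeasurableSpace X] (D : Measure (X × BinaryLabel))
    (γ : ℝ) (f : X → ℝ) : ℝ :=
  D.real {z | binaryMargin f z ≤ γ}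

open Classical in
/-- The empirical margin error, the fraction of the examples in the sample `S` with
`y f(x) < γ`. -/
def empiricalMarginError {X : Type*} {m : ℕ} (S : Fin m → X × BinaryLabel)
    (γ : ℝ) (f : X → ℝ) : ℝ :=
  ((Finset.univ.filter fun i => binaryMargin f (S i) < γ).card : ℝ) / m

/-- The misclassification loss `L(Q) = L_0(Q)` of the randomised predictor `F θ`, `θ ∼ Q`. -/
def randomisedError {X Θ : Type*} [MeasurableSpace X] [MeasurableSpace Θ]
    (D : Measure (X × BinaryLabel)) (Q : Measure Θ) (F : Θ → X → ℝ) : ℝ :=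
  ∫ θ, marginError D 0 (F θ) ∂Q

/-- The empirical margin error of the randomised predictor `F θ`, `θ ∼ Q`. -/
def randomisedEmpiricalMarginError {X Θ : Type*} [MeasurableSpace Θ] {m : ℕ}
    (S : Fin m → X × BinaryLabel) (γ : ℝ) (Q : Measure Θ) (F : Θ → X → ℝ) : ℝ :=
  ∫ θ, empiricalMarginError S γ (F θ) ∂Q

/-- The predictor `x ↦ ⟨w, φ(x)⟩`, linear in the features `φ(x)`. -/
def featurePredictor {X H : Type*} [NormedAddCommGroup H] [InnerProductSpace ℝ H]
    (w : H) (φ : X → H) : X → ℝ :=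
  fun x => inner ℝ w (φ x)

/-- The complexity `Δ = 2 log(2/δ) + 9 (R/γ)² log m + 2 KL(Q, P₀)`,
used only where the Kullback-Leibler divergence is finite. -/
def derandomisedComplexity {Θ : Type*} [MeasurableSpace Θ] (m : ℕ) (δ R γ : ℝ)
    (Q P₀ : Measure Θ) : ℝ :=
  2 * Real.log (2 / δ) + 9 * (R / γ) ^ 2 * Real.log m
    + 2 * (InformationTheory.klDiv Q P₀).toReal

end

/-! The weight `w` is derandomised by Gaussian noise. Let θ = R√(2 log m). In finite dimension, the
prior on weights is the standard Gaussian, and the posterior is the same Gaussian recentred at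
(2θ/γ)w. The noise in ⟨ω, φ(x)⟩ has standard deviation at most R, so it exceeds θ with probability
at most 1/m. An example that `w` misclassifies has noisy margin at most θ, and one with margin at
least γ has noisy margin at least θ, each outside probability 1/m. Hence the noisy predictor at
threshold θ compares the true error of Q with its empirical γ-margin error, at a cost of 1/m on each
side.

The noisy predictor obeys a PAC-Bayes bound. `integral_exp_relativeDeficit_le` bounds an exponential
moment by 2√m, and Markov's inequality together with change of measure transfers this bound to every
posterior. The Gaussian KL term is at most 4(R/γ)² log m. For γ ≤ R, the half log m from √m is
absorbed into (R/γ)² log m, which gives the constant 9 in Δ. The prior and the threshold θ do not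
involve γ, which enters only through the posterior mean, so uniformity in γ needs no union bound.

For general H, the features are projected onto finite-dimensional spaces exhausting their separable
range. Projection multiplies each 1/m by an exponential factor whose average tends to 1. Each space
has its own good event; a sample lying in infinitely many of them satisfies the limiting bound. -/

/-! ### Change of measure -/

open InformationTheory ProbabilityTheory in
/-- The Donsker-Varadhan inequality: change of measure from `Q` to `P`. -/
theorem integral_le_toReal_klDiv_add_log_integral_exp {Ω : Type*} [MeasurableSpace Ω]
    {Q P : Measure Ω} [IsProbabilityMeasure Q] [IsProbabilityMeasure P] {f : Ω → ℝ}
    (hQP : klDiv Q P ≠ ⊤) (hfQ : Integrable f Q)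
    (hfP : Integrable (fun x => Real.exp (f x)) P) :
    ∫ x, f x ∂Q ≤ (klDiv Q P).toReal + Real.log (∫ x, Real.exp (f x) ∂P) := by
  obtain ⟨hac, hint⟩ := klDiv_ne_top_iff.1 hQP
  have := isProbabilityMeasure_tilted hfP
  -- The inequality is the nonnegativity of the divergence of `Q` from the tilt of `P` by `f`.
  have h := integral_llr_tilted_right hac hfQ hfP hint
  rw [← toReal_klDiv_of_measure_eq hac (by simp),
    ← toReal_klDiv_of_measure_eq (hac.trans (absolutelyContinuous_tilted hfP)) (by simp)] at h
  have := ENNReal.toReal_nonneg (a := klDiv Q (P.tilted f))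
  linarith

/-! ### Exponential moments of binomial lower deviations -/

/-- `exp (-s) ≤ 1 - s + s² / 2` for nonnegative `s`. -/
theorem Real.exp_neg_le_quadratic {s : ℝ} (hs : 0 ≤ s) :
    Real.exp (-s) ≤ 1 - s + s ^ 2 / 2 := by
  have h := Real.quadratic_le_exp_of_nonneg hs
  rw [Real.exp_neg, inv_le_iff_one_le_mul₀ (Real.exp_pos s)]
  have h0 : 0 ≤ 1 - s + s ^ 2 / 2 := by nlinarith [sq_nonneg (s - 1)]
  have := mul_le_mul_of_nonneg_left h h0
  -- (1 - s + s²/2)(1 + s + s²/2) = 1 + s⁴/4.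
  nlinarith [sq_nonneg (s ^ 2)]

/-- The number of points of the sample `S` that lie in `A`. -/
noncomputable def sampleCount {Z : Type*} {m : ℕ} (A : Set Z) (S : Fin m → Z) : ℝ :=
  ∑ i, A.indicator (fun _ => (1 : ℝ)) (S i)

theorem sampleCount_nonneg {Z : Type*} {m : ℕ} (A : Set Z) (S : Fin m → Z) :
    0 ≤ sampleCount A S :=
  Finset.sum_nonneg fun _ _ => Set.indicator_nonneg (fun _ _ => zero_le_one) _

theorem sampleCount_le {Z : Type*} {m : ℕ} (A : Set Z) (S : Fin m → Z) :
    sampleCount A S ≤ m := by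
  calc sampleCount A S ≤ ∑ _i : Fin m, (1 : ℝ) :=
        Finset.sum_le_sum fun i _ => Set.indicator_le_self' (fun _ _ => zero_le_one) _
    _ = m := by simp

theorem measurable_sampleCount {Z : Type*} [MeasurableSpace Z] {m : ℕ} {A : Set Z}
    (hA : MeasurableSet A) : Measurable (fun S : Fin m → Z => sampleCount A S) :=
  Finset.measurable_sum _ fun i _ =>
    (measurable_const.indicator hA).comp (measurable_pi_apply i)

/-- The lower-tail moment generating function of a binomial variable is sub-Gaussian. -/
theorem integral_exp_neg_sampleCount_le {Z : Type*} [MeasurableSpace Z] (D : Measure Z)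
    [IsProbabilityMeasure D] {m : ℕ} {A : Set Z} (hA : MeasurableSet A) {s : ℝ} (hs : 0 ≤ s) :
    ∫ S : Fin m → Z, Real.exp (-(s * sampleCount A S)) ∂(Measure.pi fun _ => D) ≤
      Real.exp (m * (D.real A * (-s + s ^ 2 / 2))) := by
  have h1 : ∀ S : Fin m → Z, Real.exp (-(s * sampleCount A S)) =
      ∏ i, (fun z => Real.exp (-(s * A.indicator (fun _ => (1 : ℝ)) z))) (S i) := by
    intro S
    rw [← Real.exp_sum, sampleCount, Finset.mul_sum, Finset.sum_neg_distrib]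
  have h2 : ∀ z, Real.exp (-(s * A.indicator (fun _ => (1 : ℝ)) z)) =
      1 + A.indicator (fun _ => (1 : ℝ)) z * (Real.exp (-s) - 1) := by
    intro z
    by_cases hz : z ∈ A <;> simp [hz]
  have h3 : ∫ z, Real.exp (-(s * A.indicator (fun _ => (1 : ℝ)) z)) ∂D =
      1 + D.real A * (Real.exp (-s) - 1) := by
    simp_rw [h2]
    rw [integral_add (integrable_const _)
      (((integrable_const (1 : ℝ)).indicator hA).mul_const _), integral_mul_const,
      integral_indicator_const _ hA]
    simp
  simp_rw [h1]
  rw [integral_fintype_prod_eq_pow (μ := D)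
    (fun z => Real.exp (-(s * A.indicator (fun _ => (1 : ℝ)) z))), h3, Fintype.card_fin,
    Real.exp_nat_mul]
  have hA0 : 0 ≤ D.real A := measureReal_nonneg
  have h4 : D.real A * (Real.exp (-s) - 1) ≤ D.real A * (-s + s ^ 2 / 2) :=
    mul_le_mul_of_nonneg_left (by linarith [Real.exp_neg_le_quadratic hs]) hA0
  have h5 : 0 ≤ 1 + D.real A * (Real.exp (-s) - 1) := by
    rw [← h3]; exact integral_nonneg fun z => (Real.exp_pos _).le
  refine pow_le_pow_left₀ h5 ?_ m
  linarith [Real.add_one_le_exp (D.real A * (-s + s ^ 2 / 2))]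

/-- The relative squared deficit `m (p - q)₊² / (2 p)`, a lower bound for `m` times the binary
Kullback-Leibler divergence. -/
noncomputable def relativeDeficit (m : ℕ) (p q : ℝ) : ℝ :=
  m * (max (p - q) 0) ^ 2 / (2 * p)

theorem relativeDeficit_nonneg (m : ℕ) {p : ℝ} (hp : 0 ≤ p) (q : ℝ) :
    0 ≤ relativeDeficit m p q := by
  unfold relativeDeficit; positivity

theorem relativeDeficit_le (m : ℕ) {p q : ℝ} (hp : 0 ≤ p) (hp1 : p ≤ 1) (hq : 0 ≤ q) :
    relativeDeficit m p q ≤ m := by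
  rcases hp.eq_or_lt with rfl | hp
  · simp [relativeDeficit]
  have h : max (p - q) 0 ≤ p := max_le (by linarith) hp.le
  have h0 : 0 ≤ max (p - q) 0 := le_max_right _ _
  unfold relativeDeficit
  rw [div_le_iff₀ (by linarith)]
  have : (max (p - q) 0) ^ 2 ≤ 2 * p := by nlinarith
  exact mul_le_mul_of_nonneg_left this (Nat.cast_nonneg m)

/-- AM-GM linearises p - q ≤ √(2p · deficit/m). The right side is affine in the deficit and in p, so
it can be integrated over a posterior without a convexity argument; l is optimised afterwards. -/
theorem sub_le_relativeDeficit {m : ℕ} (hm : 0 < m) {p q l : ℝ} (hp : 0 ≤ p) (hq : 0 ≤ q)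
    (hl : 0 < l) : p - q ≤ l / m * relativeDeficit m p q + p / (2 * l) := by
  have hm' : (0 : ℝ) < m := by exact_mod_cast hm
  rcases hp.eq_or_lt with rfl | hp
  · simp [relativeDeficit]; linarith
  have h : l / m * relativeDeficit m p q + p / (2 * l) =
      max (p - q) 0 + (l * max (p - q) 0 - p) ^ 2 / (2 * p * l) := by
    unfold relativeDeficit; field_simp; ring
  rw [h]
  have : 0 ≤ (l * max (p - q) 0 - p) ^ 2 / (2 * p * l) := by positivity
  linarith [le_max_left (p - q) 0]

/-- A discrete mixture of exponentials dominates the square exponential of the positive part. -/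
theorem exp_half_sq_max_le_sum {N : ℕ} {x : ℝ} (hx : x < N + 1 / 2) :
    Real.exp ((max x 0) ^ 2 / 2) ≤
      Real.exp (1 / 8) * ∑ j ∈ Finset.range (N + 1), Real.exp (j * x - j ^ 2 / 2) := by
  -- The integer nearest to the positive part of x. For x ≥ 0 the loss in the exponent is (x - j)²/2
  -- ≤ 1/8.
  set j : ℕ := ⌊max x 0 + 1 / 2⌋₊ with hj
  have h0 : 0 ≤ max x 0 := le_max_right _ _
  have hjle : (j : ℝ) ≤ max x 0 + 1 / 2 := Nat.floor_le (by linarith)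
  have hjlt : max x 0 + 1 / 2 < j + 1 := Nat.lt_floor_add_one _
  have hjN : j ∈ Finset.range (N + 1) := by
    rw [Finset.mem_range, Nat.floor_lt (by linarith)]
    push_cast
    rcases max_choice x 0 with h | h <;> rw [h]
    · linarith
    · have : (0 : ℝ) ≤ N := Nat.cast_nonneg N
      linarith
  have hle : (max x 0) ^ 2 / 2 ≤ 1 / 8 + (j * x - j ^ 2 / 2) := by
    rcases le_total x 0 with h | h
    · have hm : max x 0 = 0 := max_eq_right h
      have : j = 0 := by rw [hj, hm, Nat.floor_eq_zero]; norm_num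
      rw [this, hm]; norm_num
    · rw [max_eq_left h] at hjle hjlt ⊢
      nlinarith
  calc Real.exp ((max x 0) ^ 2 / 2) ≤ Real.exp (1 / 8 + (j * x - j ^ 2 / 2)) :=
        Real.exp_le_exp.2 hle
    _ = Real.exp (1 / 8) * Real.exp (j * x - j ^ 2 / 2) := Real.exp_add _ _
    _ ≤ _ := mul_le_mul_of_nonneg_left
        (Finset.single_le_sum (f := fun j : ℕ => Real.exp (j * x - (j : ℝ) ^ 2 / 2))
          (fun i _ => (Real.exp_pos _).le) hjN) (Real.exp_pos _).le

/-- This is where m ≥ 4 is needed: with `exp (1 / 8)` replaced by 8/7, equality holds at m = 4. -/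
theorem exp_eighth_mul_le {m : ℕ} (hm : 4 ≤ m) :
    Real.exp (1 / 8) * (√m + 3 / 2) ≤ 2 * √m := by
  have h1 : Real.exp (1 / 8) ≤ 8 / 7 := by
    have := Real.add_one_le_exp (-(1 / 8) : ℝ)
    rw [Real.exp_neg] at this
    have h2 := inv_anti₀ (by norm_num) this
    rw [inv_inv] at h2
    linarith [h2, show ((-(1 / 8) + 1 : ℝ))⁻¹ = 8 / 7 by norm_num]
  have h2 : (2 : ℝ) ≤ √m := by
    apply Real.le_sqrt_of_sq_le
    have : (4 : ℝ) ≤ m := by exact_mod_cast hm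
    linarith
  nlinarith [Real.exp_pos (1 / 8)]

/-- With K the count and r = √(mp), the deficit is the half square of the positive part of r - K/r,
which is sub-Gaussian from above with variance 1. Its square exponential is dominated by about √m
exponentials, each of expectation at most 1. -/
theorem integral_exp_relativeDeficit_le {Z : Type*} [MeasurableSpace Z] (D : Measure Z)
    [IsProbabilityMeasure D] {m : ℕ} (hm : 4 ≤ m) {A : Set Z} (hA : MeasurableSet A) :
    ∫ S : Fin m → Z, Real.exp (relativeDeficit m (D.real A) (sampleCount A S / m))
      ∂(Measure.pi fun _ => D) ≤ 2 * √m := by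
  refine le_trans ?_ (exp_eighth_mul_le hm)
  have hm0 : (0 : ℝ) < m := by exact_mod_cast (by omega : 0 < m)
  rcases (measureReal_nonneg (μ := D) (s := A)).eq_or_lt with hp | hp
  · simp only [relativeDeficit, ← hp]
    have h1 : (1 : ℝ) ≤ Real.exp (1 / 8) := Real.one_le_exp (by norm_num)
    have h2 : 0 ≤ √(m : ℝ) := Real.sqrt_nonneg _
    simp only [mul_zero, div_zero,
      Real.exp_zero, integral_const, probReal_univ, smul_eq_mul, mul_one]
    nlinarith
  set p := D.real A with hpdef
  have hp1 : p ≤ 1 := measureReal_le_one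
  set r : ℝ := √(m * p) with hr
  have hr0 : 0 < r := Real.sqrt_pos.2 (by positivity)
  have hrsq : r ^ 2 = m * p := Real.sq_sqrt (by positivity)
  have hrm : r ≤ √m := Real.sqrt_le_sqrt (by nlinarith)
  set N : ℕ := ⌊√(m : ℝ) + 1 / 2⌋₊ with hN
  have hNlt : √(m : ℝ) + 1 / 2 < N + 1 := Nat.lt_floor_add_one _
  have hNle : (N : ℝ) ≤ √m + 1 / 2 := Nat.floor_le (by positivity)
  have hpt : ∀ S : Fin m → Z, Real.exp (relativeDeficit m p (sampleCount A S / m)) ≤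
      Real.exp (1 / 8) * ∑ j ∈ Finset.range (N + 1),
        Real.exp (j * r - j ^ 2 / 2) * Real.exp (-(j / r * sampleCount A S)) := by
    intro S
    have hx : r - sampleCount A S / r < N + 1 / 2 := by
      have : 0 ≤ sampleCount A S / r := div_nonneg (sampleCount_nonneg A S) hr0.le
      linarith
    have h := exp_half_sq_max_le_sum hx
    have e1 : relativeDeficit m p (sampleCount A S / m) =
        (max (r - sampleCount A S / r) 0) ^ 2 / 2 := by
      have e2 : p - sampleCount A S / m = r / m * (r - sampleCount A S / r) := by
        have : p = r ^ 2 / m := by rw [hrsq]; field_simp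
        rw [this]; field_simp
      have e3 : max (p - sampleCount A S / m) 0 =
          r / m * max (r - sampleCount A S / r) 0 := by
        rw [e2, mul_max_of_nonneg _ _ (by positivity), mul_zero]
      unfold relativeDeficit
      rw [e3, mul_pow, div_pow, hrsq]
      field_simp
    rw [e1]
    refine h.trans (le_of_eq ?_)
    congr 1
    refine Finset.sum_congr rfl fun j _ => ?_
    rw [← Real.exp_add]
    congr 1
    ring
  have hint : ∀ j : ℕ, Integrable (fun S : Fin m → Z =>
      Real.exp (-(j / r * sampleCount A S))) (Measure.pi fun _ => D) := by
    intro j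
    refine Integrable.of_bound (((measurable_sampleCount hA).const_mul _).neg.exp
      |>.aestronglyMeasurable) 1 (ae_of_all _ fun S => ?_)
    rw [Real.norm_eq_abs, abs_of_pos (Real.exp_pos _), Real.exp_le_one_iff]
    have := sampleCount_nonneg A S
    have : 0 ≤ (j : ℝ) / r * sampleCount A S := by positivity
    linarith
  calc ∫ S : Fin m → Z, Real.exp (relativeDeficit m p (sampleCount A S / m))
        ∂(Measure.pi fun _ => D)
      ≤ ∫ S : Fin m → Z, Real.exp (1 / 8) * ∑ j ∈ Finset.range (N + 1),
        Real.exp (j * r - j ^ 2 / 2) * Real.exp (-(j / r * sampleCount A S))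
        ∂(Measure.pi fun _ => D) := by
        refine integral_mono_of_nonneg (ae_of_all _ fun S => (Real.exp_pos _).le) ?_
          (ae_of_all _ hpt)
        exact (integrable_finsetSum _ fun j _ => (hint j).const_mul _).const_mul _
    _ = Real.exp (1 / 8) * ∑ j ∈ Finset.range (N + 1), Real.exp (j * r - j ^ 2 / 2) *
        ∫ S : Fin m → Z, Real.exp (-(j / r * sampleCount A S)) ∂(Measure.pi fun _ => D) := by
        rw [integral_const_mul, integral_finsetSum _ fun j _ => (hint j).const_mul _]
        simp_rw [integral_const_mul]
    _ ≤ Real.exp (1 / 8) * ∑ j ∈ Finset.range (N + 1), (1 : ℝ) := by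
        gcongr with j _
        refine (mul_le_mul_of_nonneg_left (integral_exp_neg_sampleCount_le D hA
          (s := j / r) (by positivity)) (Real.exp_pos _).le).trans ?_
        -- The exponents jr - j²/2 and r²(-j/r + j²/(2r²)) cancel exactly.
        rw [← Real.exp_add, Real.exp_le_one_iff]
        rw [← hpdef, ← mul_assoc, ← hrsq]
        apply le_of_eq
        field_simp
        ring
    _ ≤ _ := by
        simp only [Finset.sum_const, Finset.card_range, nsmul_eq_mul, mul_one]
        gcongr
        push_cast
        linarith

/-! ### PAC-Bayes bound for a measurable family of events -/

theorem measurable_sampleCount_section {Θ Z : Type*} [MeasurableSpace Θ] [MeasurableSpace Z]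
    {m : ℕ} {A : Set (Θ × Z)} (hA : MeasurableSet A) :
    Measurable (fun x : (Fin m → Z) × Θ => sampleCount (Prod.mk x.2 ⁻¹' A) x.1) := by
  have : ∀ x : (Fin m → Z) × Θ, sampleCount (Prod.mk x.2 ⁻¹' A) x.1 =
      ∑ i, A.indicator (fun _ => (1 : ℝ)) (x.2, x.1 i) := fun x => rfl
  simp_rw [this]
  refine Finset.measurable_sum _ fun i _ => (measurable_const.indicator hA).comp ?_
  fun_prop

theorem measurable_measureReal_section {Θ Z : Type*} [MeasurableSpace Θ] [MeasurableSpace Z]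
    (D : Measure Z) [IsProbabilityMeasure D]
    {A : Set (Θ × Z)} (hA : MeasurableSet A) :
    Measurable (fun θ => D.real (Prod.mk θ ⁻¹' A)) :=
  (measurable_measure_prodMk_left hA).ennreal_toReal

/-- The relative deficit of the sample frequency of the section of `A` at `θ`. -/
noncomputable def sectionDeficit {Θ Z : Type*} [MeasurableSpace Z]
    (D : Measure Z) {m : ℕ} (A : Set (Θ × Z)) (S : Fin m → Z)
    (θ : Θ) : ℝ :=
  relativeDeficit m (D.real (Prod.mk θ ⁻¹' A)) (sampleCount (Prod.mk θ ⁻¹' A) S / m)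

theorem sectionDeficit_nonneg {Θ Z : Type*} [MeasurableSpace Z]
    (D : Measure Z) {m : ℕ} (A : Set (Θ × Z)) (S : Fin m → Z)
    (θ : Θ) : 0 ≤ sectionDeficit D A S θ :=
  relativeDeficit_nonneg m measureReal_nonneg _

theorem sectionDeficit_le {Θ Z : Type*} [MeasurableSpace Z]
    (D : Measure Z) [IsProbabilityMeasure D] {m : ℕ} (A : Set (Θ × Z))
    (S : Fin m → Z) (θ : Θ) : sectionDeficit D A S θ ≤ m :=
  relativeDeficit_le m measureReal_nonneg measureReal_le_one
    (div_nonneg (sampleCount_nonneg _ _) (Nat.cast_nonneg m))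

theorem measurable_sectionDeficit {Θ Z : Type*} [MeasurableSpace Θ] [MeasurableSpace Z]
    (D : Measure Z) [IsProbabilityMeasure D] {m : ℕ}
    {A : Set (Θ × Z)} (hA : MeasurableSet A) :
    Measurable (fun x : (Fin m → Z) × Θ => sectionDeficit D A x.1 x.2) := by
  have h1 : Measurable fun x : (Fin m → Z) × Θ => D.real (Prod.mk x.2 ⁻¹' A) :=
    (measurable_measureReal_section D hA).comp measurable_snd
  have h2 : Measurable fun x : (Fin m → Z) × Θ => sampleCount (Prod.mk x.2 ⁻¹' A) x.1 / m :=
    (measurable_sampleCount_section hA).div_const _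
  unfold sectionDeficit relativeDeficit
  exact ((((h1.sub h2).max measurable_const).pow_const 2).const_mul _).div (h1.const_mul 2)

theorem integrable_exp_sectionDeficit {Θ Z : Type*} [MeasurableSpace Θ] [MeasurableSpace Z]
    (D : Measure Z) [IsProbabilityMeasure D] {m : ℕ}
    {A : Set (Θ × Z)} (hA : MeasurableSet A) (μ : Measure ((Fin m → Z) × Θ))
    [IsFiniteMeasure μ] :
    Integrable (fun x : (Fin m → Z) × Θ => Real.exp (sectionDeficit D A x.1 x.2)) μ := by
  refine Integrable.of_bound (measurable_sectionDeficit D hA).exp.aestronglyMeasurable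
    (Real.exp m) (ae_of_all _ fun x => ?_)
  rw [Real.norm_eq_abs, abs_of_pos (Real.exp_pos _)]
  exact Real.exp_le_exp.2 (sectionDeficit_le D A x.1 x.2)

/-- The exponential moment of the deficit is controlled with high probability over the sample. -/
theorem exists_set_integral_exp_sectionDeficit_le {Θ Z : Type*} [MeasurableSpace Θ] [MeasurableSpace Z]
    (D : Measure Z) [IsProbabilityMeasure D]
    (P : Measure Θ) [IsProbabilityMeasure P] {m : ℕ} (hm : 4 ≤ m)
    {A : Set (Θ × Z)} (hA : MeasurableSet A) {δ : ℝ} (hδ₀ : 0 < δ) :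
    ∃ E : Set (Fin m → Z), MeasurableSet E ∧
      ENNReal.ofReal (1 - δ) ≤ Measure.pi (fun _ : Fin m => D) E ∧
      ∀ S ∈ E, ∫ θ, Real.exp (sectionDeficit D A S θ) ∂P ≤ 2 * √m / δ := by
  set μ : Measure (Fin m → Z) := Measure.pi fun _ => D with hμ
  set K : ℝ := 2 * √m / δ with hK
  have hm0 : (0 : ℝ) < m := by exact_mod_cast (by omega : 0 < m)
  have hK0 : 0 < K := by have := Real.sqrt_pos.2 hm0; positivity
  have hint := integrable_exp_sectionDeficit D hA (μ.prod P)
  have hmeas : Measurable fun S : Fin m → Z => ∫ θ, Real.exp (sectionDeficit D A S θ) ∂P :=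
    ((measurable_sectionDeficit D hA).exp.stronglyMeasurable.integral_prod_right).measurable
  have htot : ∫ S, ∫ θ, Real.exp (sectionDeficit D A S θ) ∂P ∂μ ≤ 2 * √m := by
    rw [integral_integral_swap hint]
    calc ∫ θ, ∫ S, Real.exp (sectionDeficit D A S θ) ∂μ ∂P
        ≤ ∫ _θ : Θ, 2 * √(m : ℝ) ∂P := by
          refine integral_mono_of_nonneg
            (ae_of_all _ fun θ => integral_nonneg fun S => (Real.exp_pos _).le)
            (integrable_const _) (ae_of_all _ fun θ => ?_)
          exact integral_exp_relativeDeficit_le D hm (measurable_prodMk_left hA)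
      _ = 2 * √m := by simp
  refine ⟨{S | ∫ θ, Real.exp (sectionDeficit D A S θ) ∂P ≤ K},
    measurableSet_le hmeas measurable_const, ?_, fun S hS => hS⟩
  -- Markov's inequality for the prior average of the exponential, whose expectation over samples is
  -- at most 2√m = Kδ.
  have hmarkov := mul_meas_ge_le_integral_of_nonneg (μ := μ)
    (ae_of_all _ fun S => integral_nonneg fun θ => (Real.exp_pos (sectionDeficit D A S θ)).le)
    hint.integral_prod_left K
  set E : Set (Fin m → Z) := {S | ∫ θ, Real.exp (sectionDeficit D A S θ) ∂P ≤ K} with hE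
  have hEm : MeasurableSet E := measurableSet_le hmeas measurable_const
  have hcompl : μ.real Eᶜ ≤ δ := by
    have h1 : μ.real Eᶜ ≤ μ.real {S | K ≤ ∫ θ, Real.exp (sectionDeficit D A S θ) ∂P} := by
      refine measureReal_mono fun S hS => ?_
      exact (lt_of_not_ge (a := K) hS).le
    have h2 : K * μ.real {S | K ≤ ∫ θ, Real.exp (sectionDeficit D A S θ) ∂P} ≤ K * δ := by
      refine hmarkov.trans (htot.trans (le_of_eq ?_))
      rw [hK]; field_simp
    exact h1.trans (le_of_mul_le_mul_left h2 hK0)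
  have h3 : 1 - δ ≤ μ.real E := by
    have := probReal_compl_eq_one_sub (μ := μ) hEm
    linarith
  exact ENNReal.ofReal_le_of_le_toReal h3

/-- Solving the quadratic inequality `p - q ≤ √(2 p b)` for `p`, in dual form. -/
theorem le_add_sqrt_add_of_forall_sub_le {p q b : ℝ} (hp : 0 ≤ p) (hq : 0 ≤ q) (hb : 0 < b)
    (h : ∀ l : ℝ, 0 < l → p - q ≤ l * b + p / (2 * l)) :
    p ≤ q + √(2 * q * b) + 2 * b := by
  rcases hp.eq_or_lt with rfl | hp
  · positivity
  -- The minimiser of l b + p/(2l), with minimum 2lb = √(2pb).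
  set l := √(p / (2 * b)) with hl
  have hl0 : 0 < l := Real.sqrt_pos.2 (by positivity)
  have hlsq : l ^ 2 = p / (2 * b) := Real.sq_sqrt (by positivity)
  have h1 := h l hl0
  have e : p = 2 * b * l ^ 2 := by rw [hlsq]; field_simp
  have h2 : l * b + p / (2 * l) = 2 * l * b := by
    rw [e]; field_simp; ring
  rw [h2] at h1
  set s := √(2 * q * b) with hs
  have hs0 : 0 ≤ s := Real.sqrt_nonneg _
  have hssq : s ^ 2 = 2 * q * b := Real.sq_sqrt (by positivity)
  -- The number x = 2lb satisfies x(x - 2b) ≤ s², which fails once x > s + 2b.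
  have h3 : 2 * l * b ≤ s + 2 * b := by
    by_contra hcon
    push Not at hcon
    have h4 : (2 * b) * (2 * b * l ^ 2 - q) ≤ (2 * b) * (2 * l * b) := by
      apply mul_le_mul_of_nonneg_left _ (by linarith); rw [← e]; exact h1
    have h5 : (2 * l * b) * (2 * l * b - 2 * b) ≤ s ^ 2 := by rw [hssq]; nlinarith
    have h6 : s < 2 * l * b - 2 * b := by linarith
    nlinarith
  linarith

theorem integral_measureReal_section_le {Θ Z : Type*} [MeasurableSpace Θ] [MeasurableSpace Z]
    (D : Measure Z) [IsProbabilityMeasure D]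
    (Q : Measure Θ) [IsProbabilityMeasure Q] {m : ℕ} (hm : 0 < m)
    {A : Set (Θ × Z)} (hA : MeasurableSet A) (S : Fin m → Z) {B : ℝ} (hB : 0 < B)
    (h : ∫ θ, sectionDeficit D A S θ ∂Q ≤ B) :
    ∫ θ, D.real (Prod.mk θ ⁻¹' A) ∂Q ≤
      ∫ θ, sampleCount (Prod.mk θ ⁻¹' A) S / m ∂Q +
        √(2 * (∫ θ, sampleCount (Prod.mk θ ⁻¹' A) S / m ∂Q) * (B / m)) + 2 * (B / m) := by
  have hm' : (0 : ℝ) < m := by exact_mod_cast hm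
  have hq0 : ∀ θ, 0 ≤ sampleCount (Prod.mk θ ⁻¹' A) S / m :=
    fun θ => div_nonneg (sampleCount_nonneg _ _) hm'.le
  have ip : Integrable (fun θ => D.real (Prod.mk θ ⁻¹' A)) Q :=
    Integrable.of_bound (measurable_measureReal_section D hA).aestronglyMeasurable 1
      (ae_of_all _ fun θ => by
        rw [Real.norm_eq_abs, abs_of_nonneg measureReal_nonneg]; exact measureReal_le_one)
  have iq : Integrable (fun θ => sampleCount (Prod.mk θ ⁻¹' A) S / m) Q :=
    Integrable.of_bound
      (((measurable_sampleCount_section hA).comp measurable_prodMk_left).div_const _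
        |>.aestronglyMeasurable) 1
      (ae_of_all _ fun θ => by
        rw [Real.norm_eq_abs, abs_of_nonneg (hq0 θ), div_le_one hm']
        exact sampleCount_le _ _)
  have iF : Integrable (fun θ => sectionDeficit D A S θ) Q :=
    Integrable.of_bound
      ((measurable_sectionDeficit D hA).comp measurable_prodMk_left).aestronglyMeasurable m
      (ae_of_all _ fun θ => by
        rw [Real.norm_eq_abs, abs_of_nonneg (sectionDeficit_nonneg D A S θ)]
        exact sectionDeficit_le D A S θ)
  refine le_add_sqrt_add_of_forall_sub_le (integral_nonneg fun θ => measureReal_nonneg)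
    (integral_nonneg hq0) (by positivity) fun l hl => ?_
  rw [← integral_sub ip iq]
  calc ∫ θ, (D.real (Prod.mk θ ⁻¹' A) - sampleCount (Prod.mk θ ⁻¹' A) S / m) ∂Q
      ≤ ∫ θ, (l / m * sectionDeficit D A S θ + D.real (Prod.mk θ ⁻¹' A) / (2 * l)) ∂Q :=
        integral_mono (ip.sub iq) ((iF.const_mul _).add (ip.div_const _)) fun θ =>
          sub_le_relativeDeficit hm measureReal_nonneg (hq0 θ) hl
    _ = l / m * ∫ θ, sectionDeficit D A S θ ∂Q + (∫ θ, D.real (Prod.mk θ ⁻¹' A) ∂Q) / (2 * l) := by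
        rw [integral_add (iF.const_mul _) (ip.div_const _), integral_const_mul,
          integral_div]
    _ ≤ l / m * B + (∫ θ, D.real (Prod.mk θ ⁻¹' A) ∂Q) / (2 * l) := by gcongr
    _ = _ := by ring

/-! ### Gaussian vectors and their shifts -/

section GaussianVector

open ProbabilityTheory InformationTheory

variable {k : ℕ}

/-- The standard Gaussian measure on `Fin k → ℝ`. -/
noncomputable abbrev gaussianVector (k : ℕ) : Measure (Fin k → ℝ) :=
  Measure.pi fun _ => gaussianReal 0 1

theorem integral_exp_sum_mul_gaussianVector (u : Fin k → ℝ) :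
    ∫ ω, Real.exp (∑ i, u i * ω i) ∂gaussianVector k = Real.exp ((∑ i, u i ^ 2) / 2) := by
  have h1 : ∀ ω : Fin k → ℝ, Real.exp (∑ i, u i * ω i) =
      ∏ i, (fun i (x : ℝ) => Real.exp (u i * x)) i (ω i) := fun ω => Real.exp_sum _ _
  simp_rw [h1]
  rw [integral_fintype_prod_eq_prod (fun i (x : ℝ) => Real.exp (u i * x)), Finset.sum_div,
    Real.exp_sum]
  refine Finset.prod_congr rfl fun i _ => ?_
  have := mgf_gaussianReal (p := gaussianReal 0 1) (X := id) (μ := 0) (v := 1)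
    (by simp) (u i)
  simpa [mgf] using this

theorem integrable_exp_sum_mul_gaussianVector (u : Fin k → ℝ) :
    Integrable (fun ω => Real.exp (∑ i, u i * ω i)) (gaussianVector k) := by
  -- A nonintegrable function has integral 0 by convention, whereas the computed value is positive.
  by_contra h
  have := integral_undef h
  rw [integral_exp_sum_mul_gaussianVector] at this
  exact (Real.exp_pos _).ne' this

/-- The Gaussian measure on `Fin k → ℝ` with mean `a` and identity covariance. -/
noncomputable def shiftedGaussianVector (a : Fin k → ℝ) : Measure (Fin k → ℝ) :=
  (gaussianVector k).tilted fun ω => ∑ i, a i * ω i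

instance (a : Fin k → ℝ) : IsProbabilityMeasure (shiftedGaussianVector a) :=
  isProbabilityMeasure_tilted (integrable_exp_sum_mul_gaussianVector a)

theorem integral_exp_sum_mul_shiftedGaussianVector (a b : Fin k → ℝ) :
    ∫ ω, Real.exp (∑ i, b i * ω i) ∂shiftedGaussianVector a =
      Real.exp (∑ i, a i * b i + (∑ i, b i ^ 2) / 2) := by
  have h : ∀ ω : Fin k → ℝ, ∑ i, a i * ω i + ∑ i, b i * ω i = ∑ i, (a i + b i) * ω i := by
    intro ω; rw [← Finset.sum_add_distrib]; simp_rw [add_mul]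
  rw [shiftedGaussianVector, integral_exp_tilted]
  simp only [Pi.add_apply, h]
  rw [integral_exp_sum_mul_gaussianVector, integral_exp_sum_mul_gaussianVector, ← Real.exp_sub]
  congr 1
  simp_rw [add_sq, Finset.sum_add_distrib, mul_assoc, ← Finset.mul_sum]
  ring

theorem integrable_exp_sum_mul_shiftedGaussianVector (a b : Fin k → ℝ) :
    Integrable (fun ω => Real.exp (∑ i, b i * ω i)) (shiftedGaussianVector a) := by
  by_contra h
  have := integral_undef h
  rw [integral_exp_sum_mul_shiftedGaussianVector] at this
  exact (Real.exp_pos _).ne' this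

theorem shiftedGaussianVector_real_ge_le (a b : Fin k → ℝ) (c : ℝ) {t : ℝ} (ht : 0 ≤ t) :
    (shiftedGaussianVector a).real {ω | c ≤ ∑ i, b i * ω i} ≤
      Real.exp (-t * c + t * ∑ i, a i * b i + t ^ 2 * (∑ i, b i ^ 2) / 2) := by
  have h : ∀ ω : Fin k → ℝ, t * ∑ i, b i * ω i = ∑ i, (t * b i) * ω i := by
    intro ω; rw [Finset.mul_sum]; simp_rw [mul_assoc]
  have hint := integrable_exp_sum_mul_shiftedGaussianVector a (fun i => t * b i)
  have := measure_ge_le_exp_mul_mgf (μ := shiftedGaussianVector a)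
    (X := fun ω => ∑ i, b i * ω i) c ht (by simp_rw [h]; exact hint)
  refine this.trans (le_of_eq ?_)
  rw [mgf]
  simp_rw [h]
  rw [integral_exp_sum_mul_shiftedGaussianVector, ← Real.exp_add]
  congr 1
  simp_rw [mul_pow, ← Finset.mul_sum, mul_left_comm _ t, ← Finset.mul_sum]
  ring

/-- The shift is defined as an exponential tilt, so its log-density is linear minus a constant. The
mean of the linear part is the derivative at 1 of the cumulant generating function t²|a|²/2. -/
theorem klDiv_shiftedGaussianVector (a : Fin k → ℝ) :
    klDiv (shiftedGaussianVector a) (gaussianVector k) ≠ ⊤ ∧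
    (klDiv (shiftedGaussianVector a) (gaussianVector k)).toReal = (∑ i, a i ^ 2) / 2 := by
  set X : (Fin k → ℝ) → ℝ := fun ω => ∑ i, a i * ω i with hX
  have hsmul : ∀ (t : ℝ) (ω : Fin k → ℝ), t * X ω = ∑ i, (t * a i) * ω i := by
    intro t ω; rw [hX, Finset.mul_sum]; simp_rw [mul_assoc]
  have hexp : ∀ t : ℝ, Integrable (fun ω => Real.exp (t * X ω)) (gaussianVector k) := by
    intro t; simp_rw [hsmul]; exact integrable_exp_sum_mul_gaussianVector _
  have hset : integrableExpSet X (gaussianVector k) = Set.univ :=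
    Set.eq_univ_of_forall hexp
  have hcgf : cgf X (gaussianVector k) = fun t => t ^ 2 * ((∑ i, a i ^ 2) / 2) := by
    ext t
    rw [cgf, mgf]
    simp_rw [hsmul]
    rw [integral_exp_sum_mul_gaussianVector, Real.log_exp]
    simp_rw [mul_pow, ← Finset.mul_sum]
    ring
  have hmem : (1 : ℝ) ∈ interior (integrableExpSet X (gaussianVector k)) := by simp [hset]
  have hν : shiftedGaussianVector a = (gaussianVector k).tilted (fun ω => 1 * X ω) := by
    simp only [one_mul]; rfl
  have hmean : ∫ ω, X ω ∂shiftedGaussianVector a = ∑ i, a i ^ 2 := by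
    rw [hν, integral_tilted_mul_self hmem, hcgf]
    simp
    ring
  have hXint : Integrable X (shiftedGaussianVector a) := by
    rw [hν]; exact memLp_one_iff_integrable.1 (memLp_tilted_mul hmem 1)
  have hac : shiftedGaussianVector a ≪ gaussianVector k := tilted_absolutelyContinuous _ _
  have hllr : llr (shiftedGaussianVector a) (gaussianVector k)
      =ᵐ[shiftedGaussianVector a] fun ω => X ω - (∑ i, a i ^ 2) / 2 := by
    have h := hac.ae_le (log_rnDeriv_tilted_left_self
      (integrable_exp_sum_mul_gaussianVector a))
    filter_upwards [h] with ω hω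
    rw [integral_exp_sum_mul_gaussianVector, Real.log_exp] at hω
    exact hω
  refine ⟨klDiv_ne_top hac ?_, ?_⟩
  · exact (integrable_congr hllr).2 (hXint.sub (integrable_const _))
  · rw [toReal_klDiv_of_measure_eq hac (by simp), integral_congr_ae hllr,
      integral_sub hXint (integrable_const _), hmean]
    simp
    ring

end GaussianVector

/-! ### Coordinates and projection onto a finite-dimensional subspace -/

section Projection

variable {H : Type*} [NormedAddCommGroup H] [InnerProductSpace ℝ H]
  {V : Submodule ℝ H} [FiniteDimensional ℝ V] {k : ℕ} (e : OrthonormalBasis (Fin k) ℝ V)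

theorem sum_inner_mul_inner_eq_inner_starProjection (w v : H) :
    ∑ i, inner ℝ (e i : H) w * inner ℝ (e i : H) v = inner ℝ w (V.starProjection v) := by
  have h : ∀ (u : H) (i : Fin k),
      inner ℝ (e i : H) u = inner ℝ (e i) (V.orthogonalProjectionOnto u) := fun u i =>
    (Submodule.inner_orthogonalProjectionOnto_eq_of_mem_left (e i) u).symm
  rw [Submodule.starProjection_apply,
    ← Submodule.inner_orthogonalProjectionOnto_eq_of_mem_right,
    ← e.sum_inner_mul_inner (V.orthogonalProjectionOnto w)]
  refine Finset.sum_congr rfl fun i _ => ?_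
  rw [h, h, real_inner_comm]

theorem sum_inner_sq_le_norm_sq (v : H) : ∑ i, inner ℝ (e i : H) v ^ 2 ≤ ‖v‖ ^ 2 := by
  simp_rw [sq]
  rw [sum_inner_mul_inner_eq_inner_starProjection]
  refine (real_inner_le_norm _ _).trans ?_
  exact mul_le_mul_of_nonneg_left (V.norm_starProjection_apply_le v) (norm_nonneg v)

theorem norm_sub_starProjection_le (v : H) {u : H} (hu : u ∈ V) :
    ‖v - V.starProjection v‖ ≤ ‖v - u‖ := by
  rw [Submodule.starProjection_minimal]
  exact ciInf_le ⟨0, by rintro _ ⟨x, rfl⟩; exact norm_nonneg _⟩ (⟨u, hu⟩ : V)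

theorem abs_inner_starProjection_sub_inner_le {w : H} (hw : ‖w‖ ≤ 1) (v : H) :
    |inner ℝ w (V.starProjection v) - inner ℝ w v| ≤ ‖v - V.starProjection v‖ := by
  rw [← inner_sub_right, norm_sub_rev]
  refine (abs_real_inner_le_norm _ _).trans ?_
  exact mul_le_of_le_one_left (norm_nonneg _) hw

end Projection

/-! ### Product priors and posteriors -/

section ProductMeasures

variable {Φ Ω Z : Type*} [MeasurableSpace Φ] [MeasurableSpace Ω] [MeasurableSpace Z]

open InformationTheory in
/-- Change of measure for a product prior and a product posterior. -/
theorem integral_prod_le_klDiv_add_klDiv_add_log (P Q : Measure Φ) (μ ν : Measure Ω)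
    [IsProbabilityMeasure P] [IsProbabilityMeasure Q] [IsProbabilityMeasure μ]
    [IsProbabilityMeasure ν] (hQ : klDiv Q P ≠ ⊤) (hν : klDiv ν μ ≠ ⊤)
    {f : Φ × Ω → ℝ} (hf : Measurable f) (hf0 : ∀ x, 0 ≤ f x) {M : ℝ} (hM : ∀ x, f x ≤ M) :
    ∫ x, f x ∂(Q.prod ν) ≤ (klDiv Q P).toReal + (klDiv ν μ).toReal +
      Real.log (∫ x, Real.exp (f x) ∂(P.prod μ)) := by
  have hif : ∀ (ρ : Measure (Φ × Ω)) [IsFiniteMeasure ρ], Integrable f ρ := fun ρ _ =>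
    Integrable.of_bound hf.aestronglyMeasurable M (ae_of_all _ fun x => by
      rw [Real.norm_eq_abs, abs_of_nonneg (hf0 x)]; exact hM x)
  have hexp : ∀ (ρ : Measure (Φ × Ω)) [IsFiniteMeasure ρ],
      Integrable (fun x => Real.exp (f x)) ρ := fun ρ _ =>
    Integrable.of_bound hf.exp.aestronglyMeasurable (Real.exp M) (ae_of_all _ fun x => by
      rw [Real.norm_eq_abs, abs_of_pos (Real.exp_pos _)]; exact Real.exp_le_exp.2 (hM x))
  have hsec : ∀ φ, Measurable fun ω => f (φ, ω) := fun φ => hf.comp measurable_prodMk_left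
  have hsecf : ∀ φ (ρ : Measure Ω) [IsFiniteMeasure ρ], Integrable (fun ω => f (φ, ω)) ρ :=
    fun φ ρ _ => Integrable.of_bound (hsec φ).aestronglyMeasurable M (ae_of_all _ fun x => by
      rw [Real.norm_eq_abs, abs_of_nonneg (hf0 _)]; exact hM _)
  have hsece : ∀ φ (ρ : Measure Ω) [IsFiniteMeasure ρ],
      Integrable (fun ω => Real.exp (f (φ, ω))) ρ := fun φ ρ _ =>
    Integrable.of_bound (hsec φ).exp.aestronglyMeasurable (Real.exp M) (ae_of_all _ fun x => by
      rw [Real.norm_eq_abs, abs_of_pos (Real.exp_pos _)]; exact Real.exp_le_exp.2 (hM _))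
  set I : Φ → ℝ := fun φ => ∫ ω, Real.exp (f (φ, ω)) ∂μ with hI
  have hI1 : ∀ φ, 1 ≤ I φ := fun φ => by
    calc (1 : ℝ) = ∫ _ω : Ω, (1 : ℝ) ∂μ := by simp
      _ ≤ I φ := integral_mono (integrable_const _) (hsece φ μ)
        fun ω => Real.one_le_exp (hf0 _)
  have hIM : ∀ φ, I φ ≤ Real.exp M := fun φ => by
    calc I φ ≤ ∫ _ω : Ω, Real.exp M ∂μ := integral_mono (hsece φ μ) (integrable_const _)
          fun ω => Real.exp_le_exp.2 (hM _)
      _ = Real.exp M := by simp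
  have hImeas : Measurable I := hf.exp.stronglyMeasurable.integral_prod_right'.measurable
  have hIpos : ∀ φ, 0 < I φ := fun φ => zero_lt_one.trans_le (hI1 φ)
  have hlog : Integrable (fun φ => Real.log (I φ)) Q :=
    Integrable.of_bound hImeas.log.aestronglyMeasurable M (ae_of_all _ fun φ => by
      rw [Real.norm_eq_abs, abs_of_nonneg (Real.log_nonneg (hI1 φ))]
      exact (Real.log_le_iff_le_exp (hIpos φ)).2 (hIM φ))
  have hIint : Integrable (fun φ => Real.exp (Real.log (I φ))) P := by
    simp_rw [Real.exp_log (hIpos _)]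
    exact (hexp (P.prod μ)).integral_prod_left
  -- Donsker-Varadhan is applied in ω for each φ, then in φ to `log (I φ)`, so the divergence of the
  -- product measures is never computed.
  calc ∫ x, f x ∂(Q.prod ν) = ∫ φ, ∫ ω, f (φ, ω) ∂ν ∂Q := integral_prod _ (hif _)
    _ ≤ ∫ φ, ((klDiv ν μ).toReal + Real.log (I φ)) ∂Q :=
        integral_mono (hif _).integral_prod_left ((integrable_const _).add hlog) fun φ =>
          integral_le_toReal_klDiv_add_log_integral_exp hν (hsecf φ ν) (hsece φ μ)
    _ = (klDiv ν μ).toReal + ∫ φ, Real.log (I φ) ∂Q := by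
        rw [integral_add (integrable_const _) hlog]; simp
    _ ≤ (klDiv ν μ).toReal + ((klDiv Q P).toReal +
          Real.log (∫ φ, Real.exp (Real.log (I φ)) ∂P)) := by
        gcongr
        exact integral_le_toReal_klDiv_add_log_integral_exp hQ hlog hIint
    _ = _ := by
        simp_rw [Real.exp_log (hIpos _)]
        rw [integral_prod _ (hexp _)]
        ring

/-- The slice of `A` in the middle coordinate. -/
def middleSection (A : Set ((Φ × Ω) × Z)) (φ : Φ) (z : Z) : Set Ω := {ω | ((φ, ω), z) ∈ A}

theorem measurable_measureReal_middleSection (ν : Measure Ω) [IsProbabilityMeasure ν]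
    {A : Set ((Φ × Ω) × Z)} (hA : MeasurableSet A) :
    Measurable (fun x : Φ × Z => ν.real (middleSection A x.1 x.2)) :=
  measurable_measureReal_section ν (A := {p : (Φ × Z) × Ω | ((p.1.1, p.2), p.1.2) ∈ A})
    (hA.preimage (by fun_prop : Measurable fun p : (Φ × Z) × Ω => ((p.1.1, p.2), p.1.2)))

theorem integral_measureReal_section_prod (Q : Measure Φ) (ν : Measure Ω) (D : Measure Z)
    [IsProbabilityMeasure Q] [IsProbabilityMeasure ν] [IsProbabilityMeasure D]
    {A : Set ((Φ × Ω) × Z)} (hA : MeasurableSet A) :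
    ∫ θ, D.real (Prod.mk θ ⁻¹' A) ∂(Q.prod ν) =
      ∫ φ, ∫ z, ν.real (middleSection A φ z) ∂D ∂Q := by
  rw [integral_prod]
  swap
  · exact Integrable.of_bound (measurable_measureReal_section D hA).aestronglyMeasurable 1
      (ae_of_all _ fun θ => by
        rw [Real.norm_eq_abs, abs_of_nonneg measureReal_nonneg]; exact measureReal_le_one)
  congr 1
  ext φ
  set B : Set (Ω × Z) := {p | ((φ, p.1), p.2) ∈ A} with hBdef
  have hB : MeasurableSet B :=
    hA.preimage (by fun_prop : Measurable fun p : Ω × Z => ((φ, p.1), p.2))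
  have h1 : ∫ ω, D.real (Prod.mk ω ⁻¹' B) ∂ν = (ν.prod D).real B := by
    rw [measureReal_def, Measure.prod_apply hB]
    exact integral_toReal (measurable_measure_prodMk_left hB).aemeasurable
      (ae_of_all _ fun _ => measure_lt_top _ _)
  have h2 : ∫ z, ν.real ((fun ω => (ω, z)) ⁻¹' B) ∂D = (ν.prod D).real B := by
    rw [measureReal_def, Measure.prod_apply_symm hB]
    exact integral_toReal (measurable_measure_prodMk_right hB).aemeasurable
      (ae_of_all _ fun _ => measure_lt_top _ _)
  exact h1.trans h2.symm

theorem integral_sampleCount_section_prod (Q : Measure Φ) (ν : Measure Ω)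
    [IsProbabilityMeasure Q] [IsProbabilityMeasure ν] {m : ℕ} (S : Fin m → Z)
    {A : Set ((Φ × Ω) × Z)} (hA : MeasurableSet A) :
    ∫ θ, sampleCount (Prod.mk θ ⁻¹' A) S / m ∂(Q.prod ν) =
      ∫ φ, (∑ i, ν.real (middleSection A φ (S i))) / m ∂Q := by
  have hm : ∀ i, MeasurableSet {θ : Φ × Ω | (θ, S i) ∈ A} := fun i =>
    hA.preimage measurable_prodMk_right
  have h1 : ∀ θ, sampleCount (Prod.mk θ ⁻¹' A) S =
      ∑ i, {θ : Φ × Ω | (θ, S i) ∈ A}.indicator (fun _ => (1 : ℝ)) θ := fun θ => rfl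
  simp_rw [h1, integral_div]
  congr 1
  rw [integral_finsetSum _ fun i _ => (integrable_const _).indicator (hm i),
    integral_finsetSum]
  swap
  · intro i _
    exact Integrable.of_bound ((measurable_measureReal_middleSection ν hA).comp
      measurable_prodMk_right).aestronglyMeasurable 1 (ae_of_all _ fun φ => by
        rw [Real.norm_eq_abs, abs_of_nonneg measureReal_nonneg]
        exact measureReal_le_one)
  refine Finset.sum_congr rfl fun i _ => ?_
  rw [integral_indicator_const _ (hm i), smul_eq_mul, mul_one, measureReal_def,
    Measure.prod_apply (hm i)]
  exact (integral_toReal (measurable_measure_prodMk_left (hm i)).aemeasurable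
    (ae_of_all _ fun _ => measure_lt_top _ _)).symm

end ProductMeasures

/-! ### Tail of the noisy margin -/

section Tail

variable {H : Type*} [NormedAddCommGroup H] [InnerProductSpace ℝ H]
  {V : Submodule ℝ H} [FiniteDimensional ℝ V] {k : ℕ} (e : OrthonormalBasis (Fin k) ℝ V)

/-- The margin threshold at which a centred Gaussian of standard deviation `R` has tail `1 / m`. -/
noncomputable def gaussianThreshold (R : ℝ) (m : ℕ) : ℝ := R * √(2 * Real.log m)

/-- The mean of the Gaussian weight vector that derandomises to `w` at margin `γ`. -/
noncomputable def posteriorMean (R : ℝ) (m : ℕ) (γ : ℝ) (w : H) : Fin k → ℝ :=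
  fun i => 2 * gaussianThreshold R m / γ * inner ℝ (e i : H) w

theorem gaussianThreshold_sq (R : ℝ) (m : ℕ) :
    gaussianThreshold R m ^ 2 = R ^ 2 * (2 * Real.log m) := by
  have : 0 ≤ Real.log m := Real.log_natCast_nonneg m
  rw [gaussianThreshold, mul_pow, Real.sq_sqrt (by linarith)]

/-- A Chernoff bound for both signs s = ±1. `hτ` places τ at least one threshold above the mean
computed without projection; the exponential factor pays for the projection. -/
theorem shiftedGaussianVector_posteriorMean_tail {R γ : ℝ} (hR : 0 < R) (hγ : 0 < γ) {m : ℕ}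
    (hm : 1 ≤ m) {w v : H} (hw : ‖w‖ ≤ 1) (hv : ‖v‖ ≤ R) {s τ : ℝ} (hs : s ^ 2 = 1)
    (hτ : 2 * gaussianThreshold R m / γ * (s * inner ℝ w v) - τ ≤ -gaussianThreshold R m) :
    (shiftedGaussianVector (posteriorMean e R m γ w)).real
        {ω | τ ≤ s * ∑ i, inner ℝ (e i : H) v * ω i} ≤
      Real.exp (4 * Real.log m / γ * ‖v - V.starProjection v‖) / m := by
  set θ := gaussianThreshold R m with hθ
  have hθ0 : 0 ≤ θ := mul_nonneg hR.le (Real.sqrt_nonneg _)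
  have hθsq : θ ^ 2 = R ^ 2 * (2 * Real.log m) := gaussianThreshold_sq R m
  have hm0 : (0 : ℝ) < m := by exact_mod_cast hm
  -- The optimal Chernoff parameter for variance R²: tθ = 2 log m and t²R²/2 = log m, leaving -log
  -- m.
  set t := θ / R ^ 2 with ht
  have ht0 : 0 ≤ t := by positivity
  have h := shiftedGaussianVector_real_ge_le (posteriorMean e R m γ w)
    (fun i => s * inner ℝ (e i : H) v) τ ht0
  have e1 : ∀ ω : Fin k → ℝ, ∑ i, s * inner ℝ (e i : H) v * ω i =
      s * ∑ i, inner ℝ (e i : H) v * ω i := by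
    intro ω; rw [Finset.mul_sum]; simp_rw [mul_assoc]
  have e2 : ∑ i, posteriorMean e R m γ w i * (s * inner ℝ (e i : H) v) =
      2 * θ / γ * (s * inner ℝ w (V.starProjection v)) := by
    rw [← sum_inner_mul_inner_eq_inner_starProjection e, Finset.mul_sum, Finset.mul_sum]
    refine Finset.sum_congr rfl fun i _ => ?_
    rw [posteriorMean]; ring
  have e3 : ∑ i, (s * inner ℝ (e i : H) v) ^ 2 ≤ R ^ 2 := by
    simp_rw [mul_pow, hs, one_mul]
    exact (sum_inner_sq_le_norm_sq e v).trans (pow_le_pow_left₀ (norm_nonneg v) hv 2)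
  simp_rw [e1] at h
  rw [e2] at h
  refine h.trans ?_
  rw [show Real.exp (4 * Real.log m / γ * ‖v - V.starProjection v‖) / m =
    Real.exp (4 * Real.log m / γ * ‖v - V.starProjection v‖ - Real.log m) by
      rw [Real.exp_sub, Real.exp_log hm0]]
  apply Real.exp_le_exp.2
  have hη := abs_inner_starProjection_sub_inner_le (V := V) hw v
  set η := ‖v - V.starProjection v‖ with hηdef
  have h1 : s * inner ℝ w (V.starProjection v) ≤ s * inner ℝ w v + η := by
    have : s * (inner ℝ w (V.starProjection v) - inner ℝ w v) ≤ η := by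
      refine (le_abs_self _).trans ?_
      rw [abs_mul, ← Real.sqrt_sq_eq_abs s, hs, Real.sqrt_one, one_mul]
      exact hη
    linarith
  have h2 : 2 * θ / γ * (s * inner ℝ w (V.starProjection v)) ≤
      2 * θ / γ * (s * inner ℝ w v + η) := by gcongr
  have h3 : t ^ 2 * (∑ i, (s * inner ℝ (e i : H) v) ^ 2) / 2 ≤ t ^ 2 * R ^ 2 / 2 := by gcongr
  have h4 : t * (2 * θ / γ * (s * inner ℝ w (V.starProjection v)) - τ) ≤
      t * (-θ + 2 * θ / γ * η) := by
    apply mul_le_mul_of_nonneg_left _ ht0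
    linarith
  have h5 : t * θ = 2 * Real.log m := by
    rw [ht, div_mul_eq_mul_div, ← sq, hθsq]; field_simp
  have h6 : t ^ 2 * R ^ 2 = 2 * Real.log m := by
    rw [← h5, ht]; field_simp
  have h7 : t * (2 * θ / γ * η) = 4 * Real.log m / γ * η := by
    rw [show t * (2 * θ / γ * η) = (t * θ) * 2 / γ * η by ring, h5]; ring
  rw [mul_add, h7] at h4
  linarith

end Tail

/-! ### Comparison of noisy and deterministic margins -/

section FiniteDimensional

variable {X H Φ : Type*} [NormedAddCommGroup H] [InnerProductSpace ℝ H]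
  {V : Submodule ℝ H} [FiniteDimensional ℝ V] {k : ℕ} (e : OrthonormalBasis (Fin k) ℝ V)

theorem BinaryLabel.sq_eq_one (y : BinaryLabel) : (y : ℝ) ^ 2 = 1 := by
  rcases y.2 with h | h
  · rw [h]; norm_num
  · rw [Set.mem_singleton_iff.1 h]; norm_num

/-- Feature maps, weights and examples for which the margin is at most `τ`. -/
def marginSet (ev : Φ → X → H) {k : ℕ} (e : Fin k → H) (τ : ℝ) :
    Set ((Φ × (Fin k → ℝ)) × (X × BinaryLabel)) :=
  {p | (p.2.2 : ℝ) * ∑ i, inner ℝ (e i) (ev p.1.1 p.2.1) * p.1.2 i ≤ τ}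

/-- The exponential error factor due to projecting the features onto `V`. -/
noncomputable def projectionError (ev : Φ → X → H) (V : Submodule ℝ H) [FiniteDimensional ℝ V]
    (κ : ℝ) (φ : Φ) (x : X) : ℝ :=
  Real.exp (κ * ‖ev φ x - V.starProjection (ev φ x)‖)

theorem projectionError_pos (ev : Φ → X → H) (V : Submodule ℝ H) [FiniteDimensional ℝ V]
    (κ : ℝ) (φ : Φ) (x : X) : 0 < projectionError ev V κ φ x := Real.exp_pos _

theorem projectionError_le {ev : Φ → X → H} {R : ℝ} (hR : ∀ φ x, ‖ev φ x‖ ≤ R)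
    (V : Submodule ℝ H) [FiniteDimensional ℝ V] {κ : ℝ} (hκ : 0 ≤ κ) (φ : Φ) (x : X) :
    projectionError ev V κ φ x ≤ Real.exp (κ * R) := by
  refine Real.exp_le_exp.2 (mul_le_mul_of_nonneg_left ?_ hκ)
  have := norm_sub_starProjection_le (V := V) (ev φ x) V.zero_mem
  rw [sub_zero] at this
  exact this.trans (hR φ x)

theorem one_le_measureReal_middleSection_add {ev : Φ → X → H} {R γ : ℝ}
    (hR : ∀ φ x, ‖ev φ x‖ ≤ R) (hR0 : 0 < R) (hγ : 0 < γ) {m : ℕ} (hm : 1 ≤ m) {w : H}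
    (hw : ‖w‖ ≤ 1) {φ : Φ} {z : X × BinaryLabel}
    (hz : binaryMargin (featurePredictor w (ev φ)) z ≤ 0) :
    1 ≤ (shiftedGaussianVector (posteriorMean e R m γ w)).real
        (middleSection (marginSet ev (fun i => (e i : H)) (gaussianThreshold R m)) φ z) +
      projectionError ev V (4 * Real.log m / γ) φ z.1 / m := by
  set A := marginSet ev (fun i => (e i : H)) (gaussianThreshold R m) with hA
  set ν := shiftedGaussianVector (posteriorMean e R m γ w) with hν
  have hθ0 : 0 ≤ gaussianThreshold R m := mul_nonneg hR0.le (Real.sqrt_nonneg _)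
  -- The unprojected mean is at most 0, hence a full threshold below τ = θ.
  have htail := shiftedGaussianVector_posteriorMean_tail e hR0 hγ hm hw (hR φ z.1)
    (BinaryLabel.sq_eq_one z.2) (τ := gaussianThreshold R m) (by
      have : 2 * gaussianThreshold R m / γ * ((z.2 : ℝ) * inner ℝ w (ev φ z.1)) ≤ 0 :=
        mul_nonpos_of_nonneg_of_nonpos (by positivity) hz
      linarith)
  have hcover : 1 ≤ ν.real (middleSection A φ z) + ν.real
      {ω | gaussianThreshold R m ≤ z.2 * ∑ i, inner ℝ (e i : H) (ev φ z.1) * ω i} := by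
    refine (probReal_univ (μ := ν)).ge.trans
      (le_trans (measureReal_mono ?_) (measureReal_union_le _ _))
    intro ω _
    exact le_total ((z.2 : ℝ) * ∑ i, inner ℝ (e i : H) (ev φ z.1) * ω i)
      (gaussianThreshold R m)
  exact hcover.trans (add_le_add_right htail _)

theorem measureReal_middleSection_le {ev : Φ → X → H} {R γ : ℝ}
    (hR : ∀ φ x, ‖ev φ x‖ ≤ R) (hR0 : 0 < R) (hγ : 0 < γ) {m : ℕ} (hm : 1 ≤ m) {w : H}
    (hw : ‖w‖ ≤ 1) {φ : Φ} {z : X × BinaryLabel}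
    (hz : γ ≤ binaryMargin (featurePredictor w (ev φ)) z) :
    (shiftedGaussianVector (posteriorMean e R m γ w)).real
        (middleSection (marginSet ev (fun i => (e i : H)) (gaussianThreshold R m)) φ z) ≤
      projectionError ev V (4 * Real.log m / γ) φ z.1 / m := by
  have hθ0 : 0 ≤ gaussianThreshold R m := mul_nonneg hR0.le (Real.sqrt_nonneg _)
  -- The factor 2/γ in the posterior mean makes the unprojected mean at least 2θ, so falling to θ is
  -- a deviation by θ; the sign is reversed to use the upper tail.
  have htail := shiftedGaussianVector_posteriorMean_tail e hR0 hγ hm hw (hR φ z.1)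
    (s := -z.2) (by rw [neg_sq]; exact BinaryLabel.sq_eq_one z.2)
    (τ := -gaussianThreshold R m) (by
      have h1 : 2 * gaussianThreshold R m / γ * γ ≤
          2 * gaussianThreshold R m / γ * ((z.2 : ℝ) * inner ℝ w (ev φ z.1)) :=
        mul_le_mul_of_nonneg_left hz (by positivity)
      rw [div_mul_cancel₀ _ hγ.ne'] at h1
      linarith)
  refine le_trans (measureReal_mono ?_) htail
  intro ω hω
  have hω : (z.2 : ℝ) * ∑ i, inner ℝ (e i : H) (ev φ z.1) * ω i ≤ gaussianThreshold R m := hω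
  change -gaussianThreshold R m ≤ -(z.2 : ℝ) * ∑ i, inner ℝ (e i : H) (ev φ z.1) * ω i
  linarith

theorem empiricalMarginError_eq_sampleCount {m : ℕ} (S : Fin m → X × BinaryLabel) (γ : ℝ)
    (f : X → ℝ) :
    empiricalMarginError S γ f = sampleCount {z | binaryMargin f z < γ} S / m := by
  classical
  rw [empiricalMarginError, sampleCount, Finset.card_filter]
  push_cast
  congr 1

theorem empiricalMarginError_nonneg {m : ℕ} (S : Fin m → X × BinaryLabel) (γ : ℝ)
    (f : X → ℝ) : 0 ≤ empiricalMarginError S γ f := by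
  unfold empiricalMarginError; positivity

theorem empiricalMarginError_le_one {m : ℕ} (S : Fin m → X × BinaryLabel) (γ : ℝ)
    (f : X → ℝ) : empiricalMarginError S γ f ≤ 1 := by
  rw [empiricalMarginError_eq_sampleCount]
  exact div_le_one_of_le₀ (sampleCount_le _ _) (Nat.cast_nonneg m)

variable [MeasurableSpace X] [MeasurableSpace Φ]

theorem measurable_inner_eval {ev : Φ → X → H}
    (hev : StronglyMeasurable (fun p : Φ × X => ev p.1 p.2)) (w : H) :
    Measurable (fun p : Φ × X => inner ℝ w (ev p.1 p.2)) :=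
  (stronglyMeasurable_const.inner hev).measurable

theorem measurableSet_marginSet {ev : Φ → X → H}
    (hev : StronglyMeasurable (fun p : Φ × X => ev p.1 p.2)) {k : ℕ} (e : Fin k → H) (τ : ℝ) :
    MeasurableSet (marginSet ev e τ) := by
  refine measurableSet_le ?_ measurable_const
  refine Measurable.mul (by fun_prop) (Finset.measurable_sum _ fun i _ => Measurable.mul ?_ ?_)
  · exact (measurable_inner_eval hev (e i)).comp
      (by fun_prop : Measurable fun p : (Φ × (Fin k → ℝ)) × (X × BinaryLabel) =>
        (p.1.1, p.2.1))
  · fun_prop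

theorem measurable_projectionError {ev : Φ → X → H}
    (hev : StronglyMeasurable (fun p : Φ × X => ev p.1 p.2)) (V : Submodule ℝ H)
    [FiniteDimensional ℝ V] (κ : ℝ) :
    Measurable (fun p : Φ × X => projectionError ev V κ p.1 p.2) := by
  have h : StronglyMeasurable fun p : Φ × X => V.starProjection (ev p.1 p.2) :=
    V.starProjection.continuous.comp_stronglyMeasurable hev
  exact ((hev.sub h).norm.measurable.const_mul κ).exp

theorem integrable_projectionError {ev : Φ → X → H}
    (hev : StronglyMeasurable (fun p : Φ × X => ev p.1 p.2)) {R : ℝ}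
    (hR : ∀ φ x, ‖ev φ x‖ ≤ R) (V : Submodule ℝ H) [FiniteDimensional ℝ V] {κ : ℝ}
    (hκ : 0 ≤ κ) {Y : Type*} [MeasurableSpace Y] (ρ : Measure Y) [IsFiniteMeasure ρ]
    {g : Y → Φ × X} (hg : Measurable g) :
    Integrable (fun y => projectionError ev V κ (g y).1 (g y).2) ρ :=
  Integrable.of_bound ((measurable_projectionError hev V κ).comp hg).aestronglyMeasurable
    (Real.exp (κ * R)) (ae_of_all _ fun y => by
      rw [Real.norm_eq_abs, abs_of_pos (projectionError_pos ev V κ _ _)]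
      exact projectionError_le hR V hκ _ _)

theorem integrable_measureReal_middleSection_marginSet {ev : Φ → X → H}
    (hev : StronglyMeasurable (fun p : Φ × X => ev p.1 p.2)) {k : ℕ} (e : Fin k → H) (τ : ℝ)
    (ν : Measure (Fin k → ℝ)) [IsProbabilityMeasure ν]
    {Y : Type*} [MeasurableSpace Y] (ρ : Measure Y) [IsFiniteMeasure ρ]
    {g : Y → Φ × (X × BinaryLabel)} (hg : Measurable g) :
    Integrable (fun y => ν.real (middleSection (marginSet ev e τ) (g y).1 (g y).2)) ρ :=
  Integrable.of_bound ((measurable_measureReal_middleSection ν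
    (measurableSet_marginSet hev e τ)).comp hg).aestronglyMeasurable 1
    (ae_of_all _ fun y => by
      rw [Real.norm_eq_abs, abs_of_nonneg measureReal_nonneg]; exact measureReal_le_one)

theorem measurable_binaryMargin_eval {ev : Φ → X → H}
    (hev : StronglyMeasurable (fun p : Φ × X => ev p.1 p.2)) (w : H) :
    Measurable (fun p : Φ × (X × BinaryLabel) =>
      binaryMargin (featurePredictor w (ev p.1)) p.2) := by
  refine Measurable.mul (by fun_prop) ?_
  exact (measurable_inner_eval hev w).comp
    (by fun_prop : Measurable fun p : Φ × (X × BinaryLabel) => (p.1, p.2.1))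

theorem integrable_marginError {ev : Φ → X → H}
    (hev : StronglyMeasurable (fun p : Φ × X => ev p.1 p.2)) (w : H)
    (D : Measure (X × BinaryLabel)) [IsProbabilityMeasure D] (γ : ℝ)
    (Q : Measure Φ) [IsProbabilityMeasure Q] :
    Integrable (fun φ => marginError D γ (featurePredictor w (ev φ))) Q :=
  Integrable.of_bound (measurable_measureReal_section D
    (measurableSet_le (measurable_binaryMargin_eval hev w)
      measurable_const)).aestronglyMeasurable 1 (ae_of_all _ fun φ => by
        rw [Real.norm_eq_abs, marginError, abs_of_nonneg measureReal_nonneg]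
        exact measureReal_le_one)

theorem integrable_empiricalMarginError {ev : Φ → X → H}
    (hev : StronglyMeasurable (fun p : Φ × X => ev p.1 p.2)) (w : H)
    {m : ℕ} (S : Fin m → X × BinaryLabel) (γ : ℝ)
    (Q : Measure Φ) [IsProbabilityMeasure Q] :
    Integrable (fun φ => empiricalMarginError S γ (featurePredictor w (ev φ))) Q := by
  refine Integrable.of_bound ?_ 1 (ae_of_all _ fun φ => by
    rw [Real.norm_eq_abs, abs_of_nonneg (empiricalMarginError_nonneg _ _ _)]
    exact empiricalMarginError_le_one _ _ _)
  simp_rw [empiricalMarginError_eq_sampleCount]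
  exact (((measurable_sampleCount_section (measurableSet_lt (measurable_binaryMargin_eval hev w)
    measurable_const)).comp measurable_prodMk_left).div_const _).aestronglyMeasurable

theorem randomisedError_le_integral_add {ev : Φ → X → H}
    (hev : StronglyMeasurable (fun p : Φ × X => ev p.1 p.2)) {R γ : ℝ}
    (hR : ∀ φ x, ‖ev φ x‖ ≤ R) (hR0 : 0 < R) (hγ : 0 < γ) {m : ℕ} (hm : 1 ≤ m) {w : H}
    (hw : ‖w‖ ≤ 1) (D : Measure (X × BinaryLabel)) [IsProbabilityMeasure D]
    (Q : Measure Φ) [IsProbabilityMeasure Q] :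
    randomisedError D Q (fun φ => featurePredictor w (ev φ)) ≤
      ∫ φ, ∫ z, (shiftedGaussianVector (posteriorMean e R m γ w)).real
        (middleSection (marginSet ev (fun i => (e i : H)) (gaussianThreshold R m)) φ z) ∂D ∂Q +
      (∫ φ, ∫ z, projectionError ev V (4 * Real.log m / γ) φ z.1 ∂D ∂Q) / m := by
  set ν := shiftedGaussianVector (posteriorMean e R m γ w)
  have hκ : 0 ≤ 4 * Real.log m / γ := by
    have := Real.log_natCast_nonneg m
    positivity
  have i1 : Integrable (fun φ => ∫ z, ν.real (middleSection
      (marginSet ev (fun i => (e i : H)) (gaussianThreshold R m)) φ z) ∂D) Q :=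
    (integrable_measureReal_middleSection_marginSet hev (fun i => (e i : H))
      (gaussianThreshold R m) ν (Q.prod D) measurable_id).integral_prod_left
  have i2 : Integrable (fun φ =>
      (∫ z, projectionError ev V (4 * Real.log m / γ) φ z.1 ∂D) / m) Q :=
    (integrable_projectionError hev hR V hκ (Q.prod D)
      (by fun_prop : Measurable fun p : Φ × (X × BinaryLabel) =>
        (p.1, p.2.1))).integral_prod_left.div_const _
  rw [← integral_div, ← integral_add i1 i2]
  refine integral_mono (integrable_marginError hev w D 0 Q) (i1.add i2) fun φ => ?_
  have j1 := integrable_measureReal_middleSection_marginSet hev (fun i => (e i : H))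
    (gaussianThreshold R m) ν D (by fun_prop : Measurable fun z => (φ, z))
  have j2 := (integrable_projectionError hev hR V hκ D
    (by fun_prop : Measurable fun z : X × BinaryLabel => (φ, z.1)))
  have hset : MeasurableSet {z | binaryMargin (featurePredictor w (ev φ)) z ≤ 0} :=
    measurableSet_le ((measurable_binaryMargin_eval hev w).comp measurable_prodMk_left)
      measurable_const
  have hL : marginError D 0 (featurePredictor w (ev φ)) = ∫ z,
      {z | binaryMargin (featurePredictor w (ev φ)) z ≤ 0}.indicator (fun _ => (1 : ℝ)) z ∂D := by
    rw [integral_indicator_const _ hset, smul_eq_mul, mul_one, marginError]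
  change marginError D 0 (featurePredictor w (ev φ)) ≤ _
  rw [hL]
  rw [← integral_div, ← integral_add j1 (j2.div_const _)]
  refine integral_mono ((integrable_const _).indicator hset) (j1.add (j2.div_const _)) fun z => ?_
  refine Set.indicator_apply_le' (fun hz => ?_) fun _ => ?_
  · exact one_le_measureReal_middleSection_add e hR hR0 hγ hm hw hz
  · exact add_nonneg measureReal_nonneg
      (div_nonneg (projectionError_pos ev V _ _ _).le (Nat.cast_nonneg m))

theorem integral_sample_le_randomisedEmpiricalMarginError_add {ev : Φ → X → H}
    (hev : StronglyMeasurable (fun p : Φ × X => ev p.1 p.2)) {R γ : ℝ}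
    (hR : ∀ φ x, ‖ev φ x‖ ≤ R) (hR0 : 0 < R) (hγ : 0 < γ) {m : ℕ} (hm : 1 ≤ m) {w : H}
    (hw : ‖w‖ ≤ 1) (S : Fin m → X × BinaryLabel) (Q : Measure Φ) [IsProbabilityMeasure Q] :
    ∫ φ, (∑ i, (shiftedGaussianVector (posteriorMean e R m γ w)).real
        (middleSection (marginSet ev (fun i => (e i : H)) (gaussianThreshold R m)) φ (S i))) / m
          ∂Q ≤
      randomisedEmpiricalMarginError S γ Q (fun φ => featurePredictor w (ev φ)) +
      (∫ φ, (∑ i, projectionError ev V (4 * Real.log m / γ) φ (S i).1) / m ∂Q) / m := by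
  set ν := shiftedGaussianVector (posteriorMean e R m γ w)
  have hm0 : (0 : ℝ) < m := by exact_mod_cast hm
  have hκ : 0 ≤ 4 * Real.log m / γ := by
    have := Real.log_natCast_nonneg m
    positivity
  have i1 : Integrable (fun φ => (∑ i, ν.real (middleSection
      (marginSet ev (fun i => (e i : H)) (gaussianThreshold R m)) φ (S i))) / m) Q :=
    (integrable_finsetSum _ fun i _ => integrable_measureReal_middleSection_marginSet hev
      (fun i => (e i : H)) (gaussianThreshold R m) ν Q
      (by fun_prop : Measurable fun φ : Φ => (φ, S i))).div_const _
  have i2 : Integrable (fun φ => (∑ i, projectionError ev V (4 * Real.log m / γ) φ (S i).1) / m)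
      Q :=
    (integrable_finsetSum _ fun i _ => integrable_projectionError hev hR V hκ Q
      (by fun_prop : Measurable fun φ : Φ => (φ, (S i).1))).div_const _
  have i3 := integrable_empiricalMarginError hev w S γ Q
  rw [← integral_div, randomisedEmpiricalMarginError, ← integral_add i3 (i2.div_const _)]
  refine integral_mono i1 (i3.add (i2.div_const _)) fun φ => ?_
  simp only [empiricalMarginError_eq_sampleCount, sampleCount]
  rw [← add_div, Finset.sum_div _ (fun i => projectionError ev V _ φ (S i).1), ← Finset.sum_add_distrib]
  gcongr with i _
  by_cases h : binaryMargin (featurePredictor w (ev φ)) (S i) < γ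
  · rw [Set.indicator_of_mem (by exact h)]
    refine (measureReal_le_one).trans (le_add_of_nonneg_right ?_)
    exact div_nonneg (projectionError_pos ev V _ _ _).le hm0.le
  · rw [Set.indicator_of_notMem (by exact h), zero_add]
    exact measureReal_middleSection_le e hR hR0 hγ hm hw (not_lt.1 h)

end FiniteDimensional

/-! ### The bound with projection errors -/

section Bound

variable {X H Φ : Type*} [MeasurableSpace X] [NormedAddCommGroup H] [InnerProductSpace ℝ H]
  [MeasurableSpace Φ]

theorem derandomisedComplexity_ge {m : ℕ} {δ R γ : ℝ} (hδ₀ : 0 < δ) (hδ₁ : δ < 1)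
    (Q P₀ : Measure Φ) : 1 ≤ derandomisedComplexity m δ R γ Q P₀ := by
  have h1 : Real.log 2 ≤ Real.log (2 / δ) :=
    Real.log_le_log (by norm_num) (by rw [le_div_iff₀ hδ₀]; linarith)
  have h2 := Real.log_two_gt_d9
  have h3 : 0 ≤ 9 * (R / γ) ^ 2 * Real.log m :=
    mul_nonneg (by positivity) (Real.log_natCast_nonneg m)
  have h4 := ENNReal.toReal_nonneg (a := InformationTheory.klDiv Q P₀)
  unfold derandomisedComplexity
  linarith

theorem klDiv_posterior_le_half_derandomisedComplexity {m : ℕ} (hm : 1 ≤ m) {δ R γ : ℝ}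
    (hδ₀ : 0 < δ) (hγ : 0 < γ) (hγR : γ ≤ R) {V : Submodule ℝ H}
    [FiniteDimensional ℝ V] {k : ℕ} (e : OrthonormalBasis (Fin k) ℝ V) {w : H} (hw : ‖w‖ ≤ 1)
    (Q P₀ : Measure Φ) :
    (InformationTheory.klDiv Q P₀).toReal + (InformationTheory.klDiv
        (shiftedGaussianVector (posteriorMean e R m γ w)) (gaussianVector k)).toReal +
      Real.log (2 * √m / δ) ≤ derandomisedComplexity m δ R γ Q P₀ / 2 := by
  have hm0 : (0 : ℝ) < m := by exact_mod_cast hm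
  have hlog : 0 ≤ Real.log m := Real.log_natCast_nonneg m
  have h1 : Real.log (2 * √m / δ) = Real.log (2 / δ) + Real.log m / 2 := by
    rw [mul_div_right_comm, Real.log_mul (by positivity) (Real.sqrt_pos.2 hm0).ne',
      Real.log_sqrt hm0.le]
  have h2 : ∑ i, posteriorMean e R m γ w i ^ 2 ≤ 8 * (R / γ) ^ 2 * Real.log m := by
    simp_rw [posteriorMean, mul_pow, ← Finset.mul_sum, div_pow, mul_pow, gaussianThreshold_sq]
    have h3 : ∑ i, inner ℝ (e i : H) w ^ 2 ≤ 1 :=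
      (sum_inner_sq_le_norm_sq e w).trans (pow_le_one₀ (norm_nonneg w) hw)
    calc 2 ^ 2 * (R ^ 2 * (2 * Real.log m)) / γ ^ 2 * ∑ i, inner ℝ (e i : H) w ^ 2
        ≤ 2 ^ 2 * (R ^ 2 * (2 * Real.log m)) / γ ^ 2 * 1 := by gcongr
      _ = 8 * (R ^ 2 / γ ^ 2) * Real.log m := by ring
  -- Only here is γ ≤ R used: 4(R/γ)² log m from the Gaussian plus (log m)/2 from √m is at most
  -- (9/2)(R/γ)² log m.
  have h4 : Real.log m ≤ (R / γ) ^ 2 * Real.log m := by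
    refine le_mul_of_one_le_left hlog (one_le_pow₀ ?_)
    rwa [one_le_div hγ]
  rw [(klDiv_shiftedGaussianVector _).2, h1, derandomisedComplexity]
  linarith

/-- The margin bound up to the errors of projecting the features onto a finite-dimensional
space. -/
theorem exists_set_randomisedError_le_of_finiteDimensional
    {ev : Φ → X → H} (hev : StronglyMeasurable (fun p : Φ × X => ev p.1 p.2))
    {R : ℝ} (hR : ∀ φ x, ‖ev φ x‖ ≤ R)
    (D : Measure (X × BinaryLabel)) [IsProbabilityMeasure D]
    (P₀ : Measure Φ) [IsProbabilityMeasure P₀]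
    {m : ℕ} (hm : 4 ≤ m) {δ : ℝ} (hδ₀ : 0 < δ) (hδ₁ : δ < 1)
    (V : Submodule ℝ H) [FiniteDimensional ℝ V] :
    ∃ E : Set (Fin m → X × BinaryLabel), MeasurableSet E ∧
      ENNReal.ofReal (1 - δ) ≤ Measure.pi (fun _ : Fin m => D) E ∧
      ∀ S ∈ E, ∀ γ : ℝ, 0 < γ → γ ≤ R → ∀ w : H, ‖w‖ ≤ 1 →
        ∀ Q : Measure Φ, IsProbabilityMeasure Q → InformationTheory.klDiv Q P₀ ≠ ⊤ →
          ∀ q, q = randomisedEmpiricalMarginError S γ Q (fun φ => featurePredictor w (ev φ)) +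
            (∫ φ, (∑ i, projectionError ev V (4 * Real.log m / γ) φ (S i).1) / m ∂Q) / m →
          randomisedError D Q (fun φ => featurePredictor w (ev φ)) ≤
            q + √(q * derandomisedComplexity m δ R γ Q P₀ / m)
            + derandomisedComplexity m δ R γ Q P₀ / m
            + (∫ φ, ∫ z, projectionError ev V (4 * Real.log m / γ) φ z.1 ∂D ∂Q) / m := by
  have hm1 : 1 ≤ m := by omega
  set e := stdOrthonormalBasis ℝ V
  set A := marginSet ev (fun i => (e i : H)) (gaussianThreshold R m) with hAdef
  have hA : MeasurableSet A := measurableSet_marginSet hev _ _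
  obtain ⟨E, hE, hEδ, hES⟩ := exists_set_integral_exp_sectionDeficit_le D
    (P₀.prod (gaussianVector (Module.finrank ℝ V))) hm hA hδ₀
  refine ⟨E, hE, hEδ, fun S hS γ hγ hγR w hw Q hQ hKL q hq => ?_⟩
  set Δ := derandomisedComplexity m δ R γ Q P₀ with hΔ
  have hΔ1 : 1 ≤ Δ := derandomisedComplexity_ge hδ₀ hδ₁ Q P₀
  set ν := shiftedGaussianVector (posteriorMean e R m γ w) with hν
  have hR0 : 0 < R := hγ.trans_le hγR
  have hpos : 0 < ∫ θ, Real.exp (sectionDeficit D A S θ)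
      ∂(P₀.prod (gaussianVector (Module.finrank ℝ V))) := by
    refine integral_exp_pos (Integrable.of_bound ?_ (Real.exp m) (ae_of_all _ fun θ => ?_))
    · exact ((measurable_sectionDeficit D hA).comp
        measurable_prodMk_left).exp.aestronglyMeasurable
    · rw [Real.norm_eq_abs, abs_of_pos (Real.exp_pos _)]
      exact Real.exp_le_exp.2 (sectionDeficit_le D A S θ)
  have hdef : ∫ θ, sectionDeficit D A S θ ∂(Q.prod ν) ≤ Δ / 2 := by
    refine (integral_prod_le_klDiv_add_klDiv_add_log P₀ Q (gaussianVector _) ν hKL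
      (klDiv_shiftedGaussianVector _).1
      ((measurable_sectionDeficit D hA).comp measurable_prodMk_left)
      (sectionDeficit_nonneg D A S) (sectionDeficit_le D A S)).trans ?_
    refine le_trans ?_ (klDiv_posterior_le_half_derandomisedComplexity hm1 hδ₀ hγ hγR e hw Q P₀)
    gcongr
    exact hES S hS
  have hpq := integral_measureReal_section_le D (Q.prod ν) (by omega : 0 < m) hA S
    (by linarith : 0 < Δ / 2) hdef
  rw [integral_measureReal_section_prod Q ν D hA, integral_sampleCount_section_prod Q ν S hA]
    at hpq
  have hq' := integral_sample_le_randomisedEmpiricalMarginError_add e hev hR hR0 hγ hm1 hw S Q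
  have hL := randomisedError_le_integral_add e hev hR hR0 hγ hm1 hw D Q
  rw [← hq] at hq'
  refine hL.trans (add_le_add_left (hpq.trans ?_) _)
  have hs : √(2 * (∫ φ, (∑ i, ν.real (middleSection A φ (S i))) / m ∂Q) * (Δ / 2 / m)) ≤
      √(q * Δ / m) := by
    apply Real.sqrt_le_sqrt
    rw [show 2 * (∫ φ, (∑ i, ν.real (middleSection A φ (S i))) / m ∂Q) * (Δ / 2 / m) =
      (∫ φ, (∑ i, ν.real (middleSection A φ (S i))) / m ∂Q) * Δ / m by ring]
    gcongr
  have he : 2 * (Δ / 2 / m) = Δ / m := by ring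
  rw [he]
  gcongr

end Bound

/-! ### Passage to infinite dimension -/

open Filter Topology in
/-- Countably many events of probability at least `c` occur infinitely often with probability at
least `c`. -/
theorem le_measure_setOf_frequently {Ω : Type*} [MeasurableSpace Ω] (μ : Measure Ω)
    [IsFiniteMeasure μ] {E : ℕ → Set Ω} (hE : ∀ n, MeasurableSet (E n)) {c : ENNReal}
    (hc : ∀ n, c ≤ μ (E n)) :
    MeasurableSet {ω | ∃ᶠ n in atTop, ω ∈ E n} ∧ c ≤ μ {ω | ∃ᶠ n in atTop, ω ∈ E n} := by
  have h : {ω | ∃ᶠ n in atTop, ω ∈ E n} = ⋂ N, ⋃ n ≥ N, E n := by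
    ext ω; simp [frequently_atTop]
  have hmeas : ∀ N, MeasurableSet (⋃ n ≥ N, E n) := fun N =>
    MeasurableSet.iUnion fun n => MeasurableSet.iUnion fun _ => hE n
  have hanti : Antitone fun N => ⋃ n ≥ N, E n := fun M N hMN =>
    Set.biUnion_subset_biUnion_left fun n hn => le_trans hMN hn
  rw [h]
  refine ⟨MeasurableSet.iInter hmeas, ?_⟩
  have := tendsto_measure_iInter_atTop (μ := μ) (fun N => (hmeas N).nullMeasurableSet) hanti
    ⟨0, measure_ne_top _ _⟩
  refine ge_of_tendsto' this fun N => (hc N).trans (measure_mono ?_)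
  exact Set.subset_biUnion_of_mem (u := E) (le_refl N)

section Approximation

open Filter Topology

variable {X H Φ : Type*} [MeasurableSpace X] [NormedAddCommGroup H] [InnerProductSpace ℝ H]
  [MeasurableSpace Φ]

/-- Finite-dimensional subspaces whose projections converge pointwise on a separable set. -/
theorem exists_seq_finiteDimensional_tendsto_starProjection {s : Set H}
    (hs : TopologicalSpace.IsSeparable s) :
    ∃ (V : ℕ → Submodule ℝ H) (_ : ∀ n, FiniteDimensional ℝ (V n)), ∀ v ∈ s,
      Tendsto (fun n => ‖v - (V n).starProjection v‖) atTop (𝓝 0) := by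
  obtain ⟨c, hc, hsc⟩ := hs
  rcases c.eq_empty_or_nonempty with rfl | hne
  · refine ⟨fun _ => ⊥, fun _ => inferInstance, fun v hv => ?_⟩
    simpa using hsc hv
  obtain ⟨d, rfl⟩ := hc.exists_eq_range hne
  have hfin : ∀ n, FiniteDimensional ℝ (Submodule.span ℝ (d '' Set.Iic n)) := fun n =>
    FiniteDimensional.span_of_finite ℝ ((Set.finite_Iic n).image d)
  refine ⟨fun n => Submodule.span ℝ (d '' Set.Iic n), hfin, fun v hv => ?_⟩
  rw [Metric.tendsto_atTop]
  intro ε hε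
  obtain ⟨_, ⟨N, rfl⟩, hN⟩ := Metric.mem_closure_iff.1 (hsc hv) ε hε
  refine ⟨N, fun n hn => ?_⟩
  rw [Real.dist_0_eq_abs, abs_of_nonneg (norm_nonneg _)]
  refine lt_of_le_of_lt (norm_sub_starProjection_le v ?_) (by rwa [← dist_eq_norm])
  exact Submodule.subset_span ⟨N, hn, rfl⟩

/-- Dominated convergence: the uniform norm bound on the features dominates the factors by the
constant `exp (κ * R)`. -/
theorem tendsto_integral_projectionError {ev : Φ → X → H}
    (hev : StronglyMeasurable (fun p : Φ × X => ev p.1 p.2)) {R : ℝ}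
    (hR : ∀ φ x, ‖ev φ x‖ ≤ R) {V : ℕ → Submodule ℝ H} [∀ n, FiniteDimensional ℝ (V n)]
    (hV : ∀ φ x, Tendsto (fun n => ‖ev φ x - (V n).starProjection (ev φ x)‖) atTop (𝓝 0))
    {κ : ℝ} (hκ : 0 ≤ κ) {Y : Type*} [MeasurableSpace Y] (ρ : Measure Y)
    [IsProbabilityMeasure ρ] {g : Y → Φ × X} (hg : Measurable g) :
    Tendsto (fun n => ∫ y, projectionError ev (V n) κ (g y).1 (g y).2 ∂ρ) atTop (𝓝 1) := by
  have h := tendsto_integral_of_dominated_convergence (μ := ρ) (f := fun _ => (1 : ℝ))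
    (F := fun n y => projectionError ev (V n) κ (g y).1 (g y).2)
    (fun _ => Real.exp (κ * R))
    (fun n => ((measurable_projectionError hev (V n) κ).comp hg).aestronglyMeasurable)
    (integrable_const _)
    (fun n => ae_of_all _ fun y => by
      rw [Real.norm_eq_abs, abs_of_pos (projectionError_pos ev (V n) κ _ _)]
      exact projectionError_le hR (V n) hκ _ _)
    (ae_of_all _ fun y => by
      have h1 := ((hV (g y).1 (g y).2).const_mul κ).rexp
      rw [mul_zero, Real.exp_zero] at h1
      exact h1)
  simpa using h

end Approximation

/-! ### Trivial regimes -/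

section Trivial

variable {X H Φ : Type*} [NormedAddCommGroup H] [InnerProductSpace ℝ H] [MeasurableSpace Φ]

theorem randomisedError_le_one [MeasurableSpace X] (D : Measure (X × BinaryLabel)) [IsProbabilityMeasure D]
    (Q : Measure Φ) [IsProbabilityMeasure Q] (F : Φ → X → ℝ) : randomisedError D Q F ≤ 1 := by
  calc randomisedError D Q F ≤ ∫ _φ : Φ, (1 : ℝ) ∂Q :=
        integral_mono_of_nonneg (ae_of_all _ fun _ => measureReal_nonneg) (integrable_const _)
          (ae_of_all _ fun _ => measureReal_le_one)
    _ = 1 := by simp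

theorem randomisedEmpiricalMarginError_nonneg {m : ℕ} (S : Fin m → X × BinaryLabel) (γ : ℝ)
    (Q : Measure Φ) (F : Φ → X → ℝ) : 0 ≤ randomisedEmpiricalMarginError S γ Q F :=
  integral_nonneg fun _ => empiricalMarginError_nonneg _ _ _

theorem randomisedEmpiricalMarginError_eq_one {ev : Φ → X → H} {R γ : ℝ}
    (hR : ∀ φ x, ‖ev φ x‖ ≤ R) (hRγ : R < γ) {m : ℕ} (hm : 1 ≤ m) {w : H} (hw : ‖w‖ ≤ 1)
    (S : Fin m → X × BinaryLabel) (Q : Measure Φ) [IsProbabilityMeasure Q] :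
    randomisedEmpiricalMarginError S γ Q (fun φ => featurePredictor w (ev φ)) = 1 := by
  have hm0 : (m : ℝ) ≠ 0 := by exact_mod_cast (by omega : m ≠ 0)
  have h : ∀ φ, empiricalMarginError S γ (featurePredictor w (ev φ)) = 1 := by
    intro φ
    have hlt : ∀ i, binaryMargin (featurePredictor w (ev φ)) (S i) < γ := by
      intro i
      refine lt_of_le_of_lt ?_ hRγ
      refine (le_abs_self _).trans ?_
      rw [binaryMargin, abs_mul, ← Real.sqrt_sq_eq_abs ((S i).2 : ℝ),
        BinaryLabel.sq_eq_one, Real.sqrt_one, one_mul]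
      refine (abs_real_inner_le_norm _ _).trans ?_
      exact (mul_le_of_le_one_left (norm_nonneg _) hw).trans (hR _ _)
    rw [empiricalMarginError, Finset.filter_true_of_mem fun i _ => hlt i]
    simp [hm0]
  simp [randomisedEmpiricalMarginError, h]

end Trivial

/-! ### The margin bound -/

open Filter Topology in
theorem mainTheorem6
    {X H Φ : Type*} [MeasurableSpace X]
    [NormedAddCommGroup H] [InnerProductSpace ℝ H] [CompleteSpace H]
    [MeasurableSpace Φ]
    -- the space of feature maps, with its evaluation
    (ev : Φ → X → H)
    (hev : StronglyMeasurable (fun p : Φ × X => ev p.1 p.2))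
    (R : ℝ) (hR : ∀ φ x, ‖ev φ x‖ ≤ R)
    (D : Measure (X × BinaryLabel)) [IsProbabilityMeasure D]
    (P₀ : Measure Φ) [IsProbabilityMeasure P₀]
    (m : ℕ) (hm : 1 ≤ m)
    (δ : ℝ) (hδ₀ : 0 < δ) (hδ₁ : δ < 1) :
    ∃ E : Set (Fin m → X × BinaryLabel), MeasurableSet E ∧
      ENNReal.ofReal (1 - δ) ≤ Measure.pi (fun _ : Fin m => D) E ∧
      ∀ S ∈ E, ∀ γ : ℝ, 0 < γ → ∀ w : H, ‖w‖ ≤ 1 →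
        ∀ Q : Measure Φ, IsProbabilityMeasure Q → InformationTheory.klDiv Q P₀ ≠ ⊤ →
          randomisedError D Q (fun φ => featurePredictor w (ev φ)) ≤
            randomisedEmpiricalMarginError S γ Q (fun φ => featurePredictor w (ev φ))
            + √(randomisedEmpiricalMarginError S γ Q (fun φ => featurePredictor w (ev φ))
                * derandomisedComplexity m δ R γ Q P₀ / m)
            + (derandomisedComplexity m δ R γ Q P₀
                + √(derandomisedComplexity m δ R γ Q P₀) + 2) / m := by
  have hm0 : (0 : ℝ) < m := by exact_mod_cast hm
  have huniv : ENNReal.ofReal (1 - δ) ≤ Measure.pi (fun _ : Fin m => D) Set.univ := by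
    rw [measure_univ, ENNReal.ofReal_le_one]; linarith
  -- For m ≤ 3 the last term is already at least 1, because Δ ≥ 1.
  rcases Nat.lt_or_ge m 4 with hm4 | hm4
  · refine ⟨Set.univ, MeasurableSet.univ, huniv, fun S _ γ hγ w hw Q hQ hKL => ?_⟩
    have hΔ : 1 ≤ derandomisedComplexity m δ R γ Q P₀ := derandomisedComplexity_ge hδ₀ hδ₁ Q P₀
    have h1 := randomisedError_le_one D Q (fun φ => featurePredictor w (ev φ))
    have h2 := randomisedEmpiricalMarginError_nonneg S γ Q
      (fun φ => featurePredictor w (ev φ))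
    have h3 : 1 ≤ (derandomisedComplexity m δ R γ Q P₀
        + √(derandomisedComplexity m δ R γ Q P₀) + 2) / m := by
      rw [one_le_div hm0]
      have : (m : ℝ) ≤ 3 := by exact_mod_cast (by omega : m ≤ 3)
      linarith [Real.sqrt_nonneg (derandomisedComplexity m δ R γ Q P₀)]
    linarith [Real.sqrt_nonneg (randomisedEmpiricalMarginError S γ Q
      (fun φ => featurePredictor w (ev φ)) * derandomisedComplexity m δ R γ Q P₀ / m)]
  obtain ⟨V, hVfin, hV⟩ := exists_seq_finiteDimensional_tendsto_starProjection
    hev.isSeparable_range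
  have hVev : ∀ φ x, Tendsto (fun n => ‖ev φ x - (V n).starProjection (ev φ x)‖) atTop (𝓝 0) :=
    fun φ x => hV _ ⟨(φ, x), rfl⟩
  choose E hEm hEδ hES using fun n =>
    exists_set_randomisedError_le_of_finiteDimensional hev hR D P₀ hm4 hδ₀ hδ₁ (V n)
  -- The events for different subspaces need not be nested. Membership in infinitely many of them
  -- costs no probability and suffices for a limit along a subsequence that may depend on the
  -- sample.
  obtain ⟨hmeas, hprob⟩ := le_measure_setOf_frequently (Measure.pi fun _ : Fin m => D) hEm hEδ
  refine ⟨_, hmeas, hprob, fun S hS γ hγ w hw Q hQ hKL => ?_⟩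
  have hΔ : 1 ≤ derandomisedComplexity m δ R γ Q P₀ := derandomisedComplexity_ge hδ₀ hδ₁ Q P₀
  have h2 := randomisedEmpiricalMarginError_nonneg S γ Q (fun φ => featurePredictor w (ev φ))
  -- For γ > R every margin is below γ, so the empirical error is 1. This also covers R = 0.
  rcases lt_or_ge R γ with hRγ | hγR
  · have h1 := randomisedError_le_one D Q (fun φ => featurePredictor w (ev φ))
    rw [randomisedEmpiricalMarginError_eq_one hR hRγ hm hw S Q]
    have h3 : 0 ≤ (derandomisedComplexity m δ R γ Q P₀
        + √(derandomisedComplexity m δ R γ Q P₀) + 2) / m := by positivity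
    linarith [Real.sqrt_nonneg (1 * derandomisedComplexity m δ R γ Q P₀ / m)]
  have hκ : 0 ≤ 4 * Real.log m / γ := by
    have := Real.log_natCast_nonneg m
    positivity
  set L := randomisedError D Q (fun φ => featurePredictor w (ev φ))
  set q := randomisedEmpiricalMarginError S γ Q (fun φ => featurePredictor w (ev φ))
  set Δ := derandomisedComplexity m δ R γ Q P₀
  have hα : Tendsto (fun n => ∫ φ, ∫ z, projectionError ev (V n) (4 * Real.log m / γ) φ z.1
      ∂D ∂Q) atTop (𝓝 1) := by
    have hg : Measurable fun p : Φ × (X × BinaryLabel) => (p.1, p.2.1) := by fun_prop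
    refine (tendsto_integral_projectionError hev hR hVev hκ (Q.prod D) hg).congr fun n => ?_
    exact integral_prod _ (integrable_projectionError hev hR (V n) hκ (Q.prod D) hg)
  have hβ : Tendsto (fun n => ∫ φ, (∑ i, projectionError ev (V n) (4 * Real.log m / γ) φ
      (S i).1) / m ∂Q) atTop (𝓝 1) := by
    have hg : ∀ i, Measurable fun φ : Φ => (φ, (S i).1) := fun i => by fun_prop
    have h := (tendsto_finsetSum Finset.univ fun i _ =>
      tendsto_integral_projectionError hev hR hVev hκ Q (hg i)).div_const (m : ℝ)
    have hone : (∑ _i : Fin m, (1 : ℝ)) / m = 1 := by simp [hm0.ne']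
    rw [hone] at h
    refine h.congr fun n => ?_
    rw [integral_div, integral_finsetSum _ fun i _ =>
      integrable_projectionError hev hR (V n) hκ Q (hg i)]
  have hqβ := (hβ.div_const (m : ℝ)).const_add q
  have hlim := (hqβ.add ((hqβ.mul_const Δ).div_const (m : ℝ)).sqrt).add_const (Δ / m)
    |>.add (hα.div_const (m : ℝ))
  have hle : L ≤ q + 1 / m + √((q + 1 / m) * Δ / m) + Δ / m + 1 / m :=
    ge_of_tendsto_of_frequently hlim
      (hS.mono fun n hn => hES n S hn γ hγ hγR w hw Q hQ hKL _ rfl)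
  -- Subadditivity of the root: the 1/m added to the empirical error produces the √Δ/m term of the
  -- bound.
  have hsqrt : √((q + 1 / m) * Δ / m) ≤ √(q * Δ / m) + √Δ / m := by
    refine Real.sqrt_le_iff.2 ⟨by positivity, ?_⟩
    have h3 : √(q * Δ / m) ^ 2 = q * Δ / m := Real.sq_sqrt (by positivity)
    have h4 : √Δ ^ 2 = Δ := Real.sq_sqrt (by linarith)
    have h5 : (1 : ℝ) / m * Δ / m = (√Δ / m) ^ 2 := by rw [div_pow, h4]; field_simp
    have h6 : 0 ≤ √(q * Δ / m) * (√Δ / m) := by positivity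
    rw [add_mul, add_div, h5]
    linarith [add_sq (√(q * Δ / m)) (√Δ / m)]
  have hfin : (Δ + √Δ + 2) / m = Δ / m + √Δ / m + 1 / m + 1 / m := by ring
  rw [hfin]
  linarith
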